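/- Consider a C-RAN downlink in the plane. The remote radio heads (RRHs) form a homogeneous Poisson point process $\Phi_r$ on $\mathbb{R}^2$ of density $\lambda_r>0$, and the users form an independent homogeneous Poisson point process $\Phi_u$ of density $\lambda_u>0$. For an activity factor $\mu_a\in[0,1]$, each RRH is active independently with probability $\mu_a$ (it is active iff its mark, uniform on $[0,1]$ and independent of everything else, is at most $\mu_a$). Each user is served by its nearest active RRH and all other active RRHs interfere. The channel is path loss with exponent $\alpha>2$, and noise is neglected: a user at $u$ served by $x$ has $$\mathrm{SIR}(u)=\frac{|u-x|^{-\alpha}}{\sum_{y\ \mathrm{active},\,y\neq x}|u-y|^{-\alpha}},$$ and it is in coverage if $\mathrm{SIR}(u)>\gamma$, where $\gamma\ge 1$. The total bandwidth is $B>0$ and the bandwidth per user is $B\mu_a\lambda_r/\lambda_u$. The per-user data rate (in bits per second) is $$R_u(\mu_a)=\frac{B\mu_a\lambda_r}{\lambda_u}\,\tau ,$$ with $R_u(0)=0$, where $\tau$ is the mean of $\log_2(1+\mathrm{SIR})$ for a randomly chosen user in coverage: the expected sum of $\log_2(1+\mathrm{SIR}(u))$ over the covered users $u$ in a measurable window $W$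 with $0<|W|<\infty$, divided by the expected number of covered users in $W$. Let $R_0\ge 0$ and $$\mu_a^*=\frac{R_0\lambda_u}{B\lambda_r\left[\log_2(1+\gamma)+(\log_2 e)\,\gamma^{2/\alpha}\mathcal{A}(\alpha,\gamma)\right]},\qquad \mathcal{A}(\alpha,\gamma)=\int_\gamma^\infty\frac{x^{-2/\alpha}}{1+x}\,dx .$$ Then, for every choice of $W$ and every $\mu_a\in[0,1]$, $R_u(\mu_a)\ge R_0$ if and only if $\mu_a\ge\mu_a^*$. Consequently, if $\mu_a^*\le 1$, then $\mu_a^*$ is the smallest activity factor in $[0,1]$ for which $R_u\ge R_0$ holds. -/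

import Mathlib

open MeasureTheory ProbabilityTheory Set
open scoped ENNReal

noncomputable section

/-- The plane `ℝ²` with its Euclidean distance. -/
abbrev Plane : Type := EuclideanSpace ℝ (Fin 2)

/-- The number of points of the random set `Φ` that lie in `B`. -/
def pointCount {Ω E : Type*} (Φ : Ω → Set E) (B : Set E) (ω : Ω) : ℕ∞ :=
  (Φ ω ∩ B).encard

/-- The family of all counts of `Φ` in measurable sets; its σ-algebra is the σ-algebra
generated by the point process `Φ`. -/
def countFamily {Ω E : Type*} [MeasurableSpace E] (Φ : Ω → Set E) (ω : Ω) :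
    {B : Set E // MeasurableSet B} → ℕ∞ :=
  fun B => pointCount Φ B ω

/-- `Φ` is a (simple) Poisson point process with intensity measure `Λ` under `P`: a random
locally finite set of points whose counts are measurable, whose count in each measurable set
`B` of finite intensity has the Poisson law with mean `Λ B`, and whose counts in finitely many
pairwise disjoint measurable sets are independent. -/
structure IsPoissonProcess {Ω E : Type*} [MeasurableSpace Ω] [PseudoMetricSpace E]
    [MeasurableSpace E] (Φ : Ω → Set E) (Λ : Measure E) (P : Measure Ω) : Prop where
  locallyFinite : ∀ ω, ∀ B : Set E, Bornology.IsBounded B → (Φ ω ∩ B).Finite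
  measurable_count : ∀ B : Set E, MeasurableSet B → Measurable (pointCount Φ B)
  count_law : ∀ B : Set E, MeasurableSet B → Λ B ≠ ∞ → ∀ n : ℕ,
    P {ω | pointCount Φ B ω = (n : ℕ∞)} = poissonMeasure (Λ B).toNNReal {n}
  indep_counts : ∀ (n : ℕ) (B : Fin n → Set E), (∀ i, MeasurableSet (B i)) →
    Pairwise (fun i j => Disjoint (B i) (B j)) → iIndepFun (fun i => pointCount Φ (B i)) P

/-- A C-RAN: remote radio heads (RRHs), each carrying a mark in `[0,1]`, and users, on a common
probability space. The marks drive the activation of the RRHs. -/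
structure CRAN (Ω : Type*) where
  /-- the locations of all RRHs -/
  rrh : Ω → Set Plane
  /-- the mark of the RRH at a given location -/
  mark : Ω → Plane → unitInterval
  /-- the locations of the users -/
  users : Ω → Set Plane

namespace CRAN

variable {Ω : Type*} (N : CRAN Ω)

/-- The RRHs together with their marks, as a random set of points of `ℝ² × [0,1]`. -/
def markedRRH (ω : Ω) : Set (Plane × unitInterval) :=
  (fun x => (x, N.mark ω x)) '' N.rrh ω

/-- The active RRHs at activity factor `μ`: those whose mark is at most `μ`. As the marks are
independent and uniform on `[0,1]`, each RRH is active independently with probability `μ`. -/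
def activeRRH (μ : ℝ) (ω : Ω) : Set Plane :=
  {x | x ∈ N.rrh ω ∧ (N.mark ω x : ℝ) ≤ μ}

/-- The RRHs form a homogeneous Poisson process of density `lamR` and carry independent marks
uniform on `[0,1]` (together: a Poisson process on `ℝ² × [0,1]` with intensity `lamR dx dm`), the
users form a homogeneous Poisson process of density `lamU`, and the two are independent. -/
structure IsPoissonNetwork [MeasurableSpace Ω] (lamR lamU : ℝ) (P : Measure Ω) : Prop where
  rrh_poisson : IsPoissonProcess N.markedRRH
    (ENNReal.ofReal lamR • (volume : Measure Plane).prod (volume : Measure unitInterval)) P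
  users_poisson : IsPoissonProcess N.users (ENNReal.ofReal lamU • (volume : Measure Plane)) P
  indep : IndepFun (countFamily N.markedRRH) (countFamily N.users) P

end CRAN

/-- `x` is a point of `A` nearest to `u`. -/
def IsNearest (A : Set Plane) (u x : Plane) : Prop :=
  x ∈ A ∧ ∀ y ∈ A, dist u x ≤ dist u y

/-- Path loss `|u - x|^(-α)`: the power received at `u` from a transmitter at `x` of unit power. -/
def pathGain (α : ℝ) (u x : Plane) : ℝ≥0∞ := edist u x ^ (-α)

/-- The signal-to-interference ratio at `u` when it is served by `x` and all the other elements
of `A` interfere. -/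
def sirFrom (α : ℝ) (A : Set Plane) (u x : Plane) : ℝ≥0∞ :=
  pathGain α u x / ∑' y : ↥(A \ {x}), pathGain α u (y : Plane)

/-- The signal-to-interference ratio of a user at `u` that is served by the nearest element of
`A`. The supremum picks out the nearest element, which is unique with probability one. -/
def sir (α : ℝ) (A : Set Plane) (u : Plane) : ℝ≥0∞ :=
  ⨆ (x : Plane) (_ : IsNearest A u x), sirFrom α A u x

/-- A user at `u` is in coverage at the threshold `γ`. -/
def InCoverage (α γ : ℝ) (A : Set Plane) (u : Plane) : Prop :=
  ENNReal.ofReal γ < sir α A u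

/-- `log₂ (1 + SIR)`, in bits per second per hertz. (The ratio is finite with probability one.) -/
def spectralEfficiency (α : ℝ) (A : Set Plane) (u : Plane) : ℝ≥0∞ :=
  ENNReal.ofReal (Real.logb 2 (1 + (sir α A u).toReal))

namespace CRAN

variable {Ω : Type*} (N : CRAN Ω)

open Classical in
/-- The mean number of users in the window `W` that are in coverage. -/
def meanCovered [MeasurableSpace Ω] (P : Measure Ω) (W : Set Plane) (α γ μ : ℝ) : ℝ≥0∞ :=
  ∫⁻ ω, ∑' u : ↥(N.users ω ∩ W),
    (if InCoverage α γ (N.activeRRH μ ω) (u : Plane) then 1 else 0) ∂P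

open Classical in
/-- The mean of the sum of the spectral efficiencies of the users in the window `W` that are in
coverage. -/
def meanCoveredEfficiency [MeasurableSpace Ω] (P : Measure Ω) (W : Set Plane) (α γ μ : ℝ) :
    ℝ≥0∞ :=
  ∫⁻ ω, ∑' u : ↥(N.users ω ∩ W),
    (if InCoverage α γ (N.activeRRH μ ω) (u : Plane) then
      spectralEfficiency α (N.activeRRH μ ω) (u : Plane) else 0) ∂P

/-- The mean spectral efficiency of a randomly chosen user of the window `W`, given that it is in
coverage (the Palm average over the users). -/
def coveredEfficiency [MeasurableSpace Ω] (P : Measure Ω) (W : Set Plane) (α γ μ : ℝ) : ℝ≥0∞ :=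
  N.meanCoveredEfficiency P W α γ μ / N.meanCovered P W α γ μ

/-- The per-user data rate: the bandwidth per user `B (μ lamR) / lamU`, where `μ lamR` is the
density of active RRHs, times the mean spectral efficiency of a user in coverage. -/
def perUserRate [MeasurableSpace Ω] (P : Measure Ω) (W : Set Plane)
    (lamR lamU bw α γ μ : ℝ) : ℝ≥0∞ :=
  ENNReal.ofReal (bw * (μ * lamR) / lamU) * N.coveredEfficiency P W α γ μ

end CRAN

/-- `A(α,γ) = ∫_γ^∞ x^(-2/α) / (1+x) dx`. -/
def coverageIntegral (α γ : ℝ) : ℝ :=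
  ∫ x in Ioi γ, x ^ (-2 / α) / (1 + x)

/-- The threshold activity factor, for rates in bits per second (the factor `1 / log 2` is
`log₂ e`). -/
def minActivity (lamR lamU bw α γ R₀ : ℝ) : ℝ :=
  R₀ * lamU /
    (bw * lamR * (Real.logb 2 (1 + γ) + γ ^ (2 / α) * coverageIntegral α γ / Real.log 2))

end

/-! The rate is linear in the activity factor because `τ` depends neither on `μ > 0` nor on `W`; the
threshold `minActivity` is then the solution of a linear equation.

The key is that thresholds `t ≥ 1` are considered. At most one transmitter `x` can have a gain
exceeding `t` times the sum of all other gains, and it is then the nearest one (`lt_sir_iff`). Hence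
the indicator of `SIR > t` equals the number of such transmitters. The Mecke formula turns its mean
into `c ∫ P(I < |v|^(-α) / t) dv`, where `c` is the density of active RRHs and `I` is the total
power received from the whole process. The substitution `v ↦ t^(1/α) v` pulls out the factor
`t^(-2/α)`, so `P(SIR > t) = t^(-2/α) P(SIR > 1)` (`measure_lt_sir_eq_rpow`), and the law of `I` is
never needed.

Given coverage, the SIR is therefore Pareto on `(γ, ∞)`. The layer-cake formula for `log₂ (1 + SIR)`
gives `log₂ (1 + γ)` from levels below `γ` and the integral `A(α,γ)` from levels above
(`lintegral_coveredEfficiency`). Campbell's formula for the users, who are independent of the RRHs,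
reduces the ratio over `W` to this constant (`coveredEfficiency_eq`).

The Mecke formula is derived from the laws and independence of the counts: first for sums of a
simple function over the process, then by monotone approximation. -/

/-! ### Point processes as random counting measures -/

/-- A random locally finite set of points whose counts in measurable sets are measurable. -/
structure IsRandomPointSet {Ω E : Type*} [MeasurableSpace Ω] [PseudoMetricSpace E]
    [MeasurableSpace E] (Φ : Ω → Set E) : Prop where
  locallyFinite : ∀ ω, ∀ B : Set E, Bornology.IsBounded B → (Φ ω ∩ B).Finite
  measurable_count : ∀ B : Set E, MeasurableSet B → Measurable (pointCount Φ B)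

theorem IsPoissonProcess.isRandomPointSet {Ω E : Type*} [MeasurableSpace Ω] [PseudoMetricSpace E]
    [MeasurableSpace E] {Φ : Ω → Set E} {Λ : Measure E} {P : Measure Ω}
    (h : IsPoissonProcess Φ Λ P) : IsRandomPointSet Φ :=
  ⟨h.locallyFinite, h.measurable_count⟩

/-- The masses need not be uniformly bounded, so the source space is sliced by the integer part of
the total mass; on each slice the bound is uniform. -/
theorem ProbabilityTheory.Kernel.isSFiniteKernel_of_isFiniteMeasure {α β : Type*}
    [MeasurableSpace α] [MeasurableSpace β] (κ : Kernel α β) [∀ a, IsFiniteMeasure (κ a)] :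
    IsSFiniteKernel κ := by
  classical
  have hs : ∀ n : ℕ, MeasurableSet {a | ⌊(κ a univ).toNNReal⌋₊ = n} := fun n =>
    (Nat.measurable_floor.comp
      (Kernel.measurable_coe κ MeasurableSet.univ).ennreal_toNNReal) (measurableSet_singleton n)
  have hsum : κ = Kernel.sum fun n => Kernel.piecewise (hs n) κ 0 := by
    ext a s hsm
    rw [Kernel.sum_apply' _ _ hsm, tsum_eq_single ⌊(κ a univ).toNNReal⌋₊]
    · simp [Kernel.piecewise_apply]
    · intro n hn
      simp [Kernel.piecewise_apply, hn.symm]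
  have hfin : ∀ n, IsFiniteKernel (Kernel.piecewise (hs n) κ 0) := by
    intro n
    refine ⟨⟨(n + 1 : ℕ), by simp, fun a => ?_⟩⟩
    rw [Kernel.piecewise_apply]
    split_ifs with h
    · have h1 := Nat.lt_floor_add_one (κ a univ).toNNReal
      rw [show ⌊(κ a univ).toNNReal⌋₊ = n from h] at h1
      rw [← ENNReal.coe_toNNReal (measure_ne_top (κ a) univ)]
      exact_mod_cast h1.le
    · simp
  rw [hsum]
  infer_instance

namespace IsRandomPointSet

variable {Ω E : Type*} [MeasurableSpace Ω] [MetricSpace E] [MeasurableSpace E]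
  {Φ : Ω → Set E}

theorem countable (h : IsRandomPointSet Φ) (ω : Ω) : (Φ ω).Countable := by
  rcases (Φ ω).eq_empty_or_nonempty with h0 | ⟨x, -⟩
  · simp [h0]
  · have : Φ ω = ⋃ n : ℕ, Φ ω ∩ Metric.closedBall x n := by
      rw [← inter_iUnion, Metric.iUnion_closedBall_nat, inter_univ]
    rw [this]
    exact countable_iUnion fun n => (h.locallyFinite ω _ Metric.isBounded_closedBall).countable

variable [BorelSpace E]

/-- The random counting measure of a point process. -/
noncomputable def kernel (h : IsRandomPointSet Φ) : Kernel Ω E where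
  toFun ω := Measure.count.restrict (Φ ω)
  measurable' := by
    refine Measure.measurable_of_measurable_coe _ fun B hB => ?_
    have : (fun ω => Measure.count.restrict (Φ ω) B) = fun ω => (pointCount Φ B ω : ℝ≥0∞) := by
      ext ω
      rw [Measure.restrict_apply hB,
        Measure.count_apply (hB.inter (h.countable ω).measurableSet), inter_comm, pointCount]
    rw [this]
    exact Measurable.of_discrete.comp (h.measurable_count B hB)

theorem kernel_eq (h : IsRandomPointSet Φ) (ω : Ω) :
    h.kernel ω = Measure.count.restrict (Φ ω) := rfl

theorem kernel_apply (h : IsRandomPointSet Φ) (ω : Ω) {B : Set E} (hB : MeasurableSet B) :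
    h.kernel ω B = (pointCount Φ B ω : ℝ≥0∞) := by
  rw [kernel_eq, Measure.restrict_apply hB,
    Measure.count_apply (hB.inter (h.countable ω).measurableSet), inter_comm, pointCount]

theorem lintegral_kernel (h : IsRandomPointSet Φ) (ω : Ω) (f : E → ℝ≥0∞) :
    ∫⁻ x, f x ∂h.kernel ω = ∑' x : ↥(Φ ω), f x := by
  rw [kernel_eq, lintegral_countable _ (h.countable ω)]
  simp

theorem setLIntegral_kernel (h : IsRandomPointSet Φ) (ω : Ω) {B : Set E} (hB : MeasurableSet B)
    (f : E → ℝ≥0∞) : ∫⁻ x in B, f x ∂h.kernel ω = ∑' x : ↥(Φ ω ∩ B), f x := by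
  rw [kernel_eq, Measure.restrict_restrict hB, inter_comm,
    lintegral_countable _ ((h.countable ω).mono inter_subset_left)]
  simp

/-- Local finiteness makes the kernel finite on each bounded shell between concentric balls, and
countably many shells fill the space. This is what permits Fubini arguments and measurability of
integrals against the process. -/
instance (h : IsRandomPointSet Φ) : IsSFiniteKernel h.kernel := by
  rcases isEmpty_or_nonempty E with hE | ⟨⟨x⟩⟩
  · have : h.kernel = 0 := by
      ext ω s
      simp [Set.eq_empty_of_isEmpty s]
    rw [this]
    infer_instance
  · let D : ℕ → Set E := disjointed fun n => Metric.closedBall x n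
    have hD : ∀ n, MeasurableSet (D n) :=
      MeasurableSet.disjointed fun n => measurableSet_closedBall
    have hU : ⋃ n, D n = univ := by
      rw [iUnion_disjointed, Metric.iUnion_closedBall_nat]
    have hsum : h.kernel = Kernel.sum fun n => h.kernel.restrict (hD n) := by
      ext ω s hs
      rw [Kernel.sum_apply' _ _ hs]
      simp_rw [Kernel.restrict_apply]
      rw [← Measure.sum_apply _ hs, ← Measure.restrict_iUnion (disjoint_disjointed _) hD, hU,
        Measure.restrict_univ]
    have : ∀ n, IsSFiniteKernel (h.kernel.restrict (hD n)) := by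
      intro n
      have : ∀ ω, IsFiniteMeasure (h.kernel.restrict (hD n) ω) := by
        intro ω
        refine ⟨?_⟩
        rw [Kernel.restrict_apply, Measure.restrict_apply_univ, h.kernel_eq,
          Measure.restrict_apply (hD n), Measure.count_apply_lt_top, inter_comm]
        exact h.locallyFinite ω _ (Metric.isBounded_closedBall.subset (disjointed_subset _ n))
      exact Kernel.isSFiniteKernel_of_isFiniteMeasure _
    rw [hsum]
    infer_instance

/-- Integrals of jointly measurable functions against the counting measure are measurable. -/
theorem measurable_lintegral {X : Type*} [MeasurableSpace X] (h : IsRandomPointSet Φ)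
    {f : (Ω × X) × E → ℝ≥0∞} (hf : Measurable f) :
    Measurable fun p : Ω × X => ∫⁻ y, f (p, y) ∂h.kernel p.1 :=
  Measurable.lintegral_kernel_prod_right' (κ := Kernel.prodMkRight X h.kernel) hf

/-- Deleting a point that varies with the parameter stays jointly measurable because the diagonal of
a second-countable space is measurable. -/
theorem measurable_lintegral_compl [SecondCountableTopology E] (h : IsRandomPointSet Φ)
    {X : Type*} [MeasurableSpace X] {g : X → E} (hg : Measurable g)
    {f : X × E → ℝ≥0∞} (hf : Measurable f) :
    Measurable fun p : Ω × X => ∫⁻ y in {g p.2}ᶜ, f (p.2, y) ∂h.kernel p.1 := by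
  have hs : MeasurableSet {q : (Ω × X) × E | q.2 ≠ g q.1.2} :=
    (measurableSet_eq_fun measurable_snd (by fun_prop)).compl
  have := h.measurable_lintegral (X := X)
    (f := {q : (Ω × X) × E | q.2 ≠ g q.1.2}.indicator fun q => f (q.1.2, q.2))
    ((hf.comp (by fun_prop)).indicator hs)
  convert this using 2 with p
  rw [← lintegral_indicator (measurableSet_singleton _).compl]
  rfl

end IsRandomPointSet

/-! ### Mecke and Campbell formulas -/

/-- The weights satisfy `(n + 1) p (n + 1) = r p n`. This is the Mecke formula for a single count.
-/
theorem lintegral_poissonMeasure_shift (r : NNReal) (g : ℕ → ℝ≥0∞) :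
    ∫⁻ n, n * g (n - 1) ∂poissonMeasure r = r * ∫⁻ n, g n ∂poissonMeasure r := by
  rw [lintegral_countable', lintegral_countable', tsum_eq_zero_add' ENNReal.summable,
    ← ENNReal.tsum_mul_left]
  simp only [Nat.cast_zero, zero_mul, zero_add, Nat.add_sub_cancel]
  refine tsum_congr fun n => ?_
  have : ((n + 1 : ℕ) : ℝ≥0∞) * poissonMeasure r {n + 1} = r * poissonMeasure r {n} := by
    rw [poissonMeasure_singleton, poissonMeasure_singleton, ← ENNReal.ofReal_natCast,
      ← ENNReal.ofReal_coe_nnreal, ← ENNReal.ofReal_mul (by positivity),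
      ← ENNReal.ofReal_mul (by positivity)]
    congr 1
    rw [Nat.factorial_succ]
    push_cast
    field_simp
    ring
  rw [mul_right_comm, this]
  ring

namespace IsPoissonProcess

variable {Ω E : Type*} [MeasurableSpace Ω] [MetricSpace E] [MeasurableSpace E]
  {Φ : Ω → Set E} {Λ : Measure E} {P : Measure Ω}

theorem map_pointCount [IsProbabilityMeasure P] (h : IsPoissonProcess Φ Λ P) {B : Set E}
    (hB : MeasurableSet B) (hΛ : Λ B ≠ ∞) :
    P.map (pointCount Φ B) = (poissonMeasure (Λ B).toNNReal).map (Nat.cast : ℕ → ℕ∞) := by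
  have hm := h.measurable_count B hB
  have hprob : IsProbabilityMeasure (P.map (pointCount Φ B)) :=
    Measure.isProbabilityMeasure_map hm.aemeasurable
  have hnat : ∀ n : ℕ, P.map (pointCount Φ B) {(n : ℕ∞)} =
      (poissonMeasure (Λ B).toNNReal).map (Nat.cast : ℕ → ℕ∞) {(n : ℕ∞)} := by
    intro n
    rw [Measure.map_apply hm (measurableSet_singleton _),
      Measure.map_apply .of_discrete (measurableSet_singleton _)]
    refine (h.count_law B hB hΛ n).trans (congrArg _ ?_)
    ext m
    simp
  have hrange : ∀ ν : Measure ℕ∞, ν (range (Nat.cast : ℕ → ℕ∞)) = ∑' n : ℕ, ν {(n : ℕ∞)} := by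
    intro ν
    rw [← measure_iUnion (fun i j hij => by simpa using hij)
      fun n => measurableSet_singleton _]
    congr 1
    ext x
    simp
  have htop : ({⊤} : Set ℕ∞) = (range (Nat.cast : ℕ → ℕ∞))ᶜ := by
    ext x
    cases x <;> simp
  -- The count law speaks of finite values only; the mass at `⊤` follows since both measures have
  -- total mass one.
  refine Measure.ext_of_singleton fun x => ?_
  cases x with
  | coe n => exact hnat n
  | top =>
    rw [htop, prob_compl_eq_one_sub .of_discrete, prob_compl_eq_one_sub .of_discrete, hrange,
      hrange]
    simp_rw [hnat]

theorem indepFun_of_fintype (h : IsPoissonProcess Φ Λ P) {ι : Type*} [Fintype ι]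
    {B : ι → Set E} (hB : ∀ i, MeasurableSet (B i))
    (hd : Pairwise fun i j => Disjoint (B i) (B j)) :
    iIndepFun (fun i => pointCount Φ (B i)) P := by
  let e := Fintype.equivFin ι
  have := (h.indep_counts _ (fun i => B (e.symm i)) (fun i => hB _)
    (fun i j hij => hd (e.symm.injective.ne hij))).precomp e.injective
  simpa using this

variable [BorelSpace E]

/-- The integral is a linear combination of the counts in the fibres of `s` outside `B`, and these
sets and `B` are pairwise disjoint. -/
theorem indepFun_lintegral_compl (h : IsPoissonProcess Φ Λ P) (s : SimpleFunc E ℝ≥0∞) {B : Set E}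
    (hB : MeasurableSet B) :
    IndepFun (fun ω => ∫⁻ y in Bᶜ, s y ∂h.isRandomPointSet.kernel ω)
      (fun ω => h.isRandomPointSet.kernel ω B) P := by
  classical
  let C : Option s.range → Set E := fun o => o.elim B fun w => s ⁻¹' {(w : ℝ≥0∞)} ∩ Bᶜ
  have hC : ∀ o, MeasurableSet (C o) := by
    rintro (_ | w)
    · exact hB
    · exact (s.measurableSet_fiber _).inter hB.compl
  have hd : Pairwise fun i j => Disjoint (C i) (C j) := by
    rintro (_ | v) (_ | w) hvw
    · exact absurd rfl hvw
    · exact disjoint_compl_right.mono_right inter_subset_right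
    · exact disjoint_compl_left.mono_left inter_subset_right
    · refine (Disjoint.preimage s ?_).mono inter_subset_left inter_subset_left
      exact disjoint_singleton.2 fun hvw' => hvw (congrArg some (Subtype.ext hvw'))
  let c : Option s.range → ℕ∞ → ℝ≥0∞ := fun o n => o.elim (n : ℝ≥0∞) fun w => w * (n : ℝ≥0∞)
  have hi := iIndepFun.indepFun_finsetSum_of_notMem
    ((h.indepFun_of_fintype hC hd).comp c fun o => .of_discrete)
    (fun o => Measurable.of_discrete.comp (h.measurable_count _ (hC o)))
    (s := Finset.univ.erase none) (i := none) (by simp)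
  convert hi using 1
  · ext ω
    rw [SimpleFunc.lintegral_eq_lintegral, SimpleFunc.lintegral, Finset.sum_apply,
      ← Finset.sum_coe_sort]
    have : (Finset.univ.erase none : Finset (Option s.range)) =
        Finset.univ.map Function.Embedding.some := by
      ext o
      cases o <;> simp
    rw [this, Finset.sum_map]
    refine Finset.sum_congr rfl fun w _ => ?_
    rw [Measure.restrict_apply (s.measurableSet_fiber _),
      h.isRandomPointSet.kernel_apply _ ((s.measurableSet_fiber _).inter hB.compl)]
    rfl
  · ext ω
    rw [h.isRandomPointSet.kernel_apply ω hB]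
    rfl

/-- The Mecke formula for a functional of `∫ s dΦ`, `s` simple, on a part of a fibre of `s`. -/
theorem lintegral_simpleFunc_fiber [SecondCountableTopology E] [IsProbabilityMeasure P]
    (h : IsPoissonProcess Φ Λ P) (s : SimpleFunc E ℝ≥0∞) {B : Set E} (hB : MeasurableSet B)
    (hΛ : Λ B ≠ ∞) {v : ℝ≥0∞} (hv : ∀ x ∈ B, s x = v) {H : ℝ≥0∞ → ℝ≥0∞} (hH : Measurable H) :
    ∫⁻ ω, ∫⁻ x in B, H (∫⁻ y in {x}ᶜ, s y ∂h.isRandomPointSet.kernel ω)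
        ∂h.isRandomPointSet.kernel ω ∂P =
      Λ B * ∫⁻ ω, H (∫⁻ y, s y ∂h.isRandomPointSet.kernel ω) ∂P := by
  have hp := h.isRandomPointSet
  let Y : Ω → ℝ≥0∞ := fun ω => ∫⁻ y in Bᶜ, s y ∂hp.kernel ω
  let N : Ω → ℝ≥0∞ := fun ω => hp.kernel ω B
  have hN : Measurable N := Kernel.measurable_coe _ hB
  have hY : Measurable Y := by
    have := (s.measurable.indicator hB.compl).lintegral_kernel (κ := hp.kernel)
    simpa only [lintegral_indicator hB.compl] using this
  have hsplit : ∀ ω, ∫⁻ y, s y ∂hp.kernel ω = Y ω + v * N ω := by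
    intro ω
    rw [← lintegral_add_compl _ hB, add_comm]
    congr 1
    rw [setLIntegral_congr_fun hB (fun x hx => hv x hx), setLIntegral_const]
  -- Since `s` is constant on `B`, removing a point of `B` only lowers the count by one, whichever
  -- point it is.
  have hsplit' : ∀ ω, ∀ x ∈ Φ ω ∩ B,
      ∫⁻ y in {x}ᶜ, s y ∂hp.kernel ω = Y ω + v * (N ω - 1) := by
    intro ω x hx
    have hBx : MeasurableSet (B \ {x}) := hB.diff (measurableSet_singleton x)
    have hset : ({x}ᶜ : Set E) = Bᶜ ∪ B \ {x} := by
      ext y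
      by_cases hy : y ∈ B
      · simp [hy]
      · have : y ≠ x := fun hyx => hy (hyx ▸ hx.2)
        simp [hy, this]
    rw [hset, lintegral_union hBx (disjoint_compl_left.mono_right sdiff_subset)]
    congr 1
    rw [setLIntegral_congr_fun hBx (fun y hy => hv y hy.1), setLIntegral_const]
    congr 1
    rw [hp.kernel_apply ω hBx, show N ω = _ from hp.kernel_apply ω hB, pointCount, pointCount,
      ← inter_sdiff_assoc, encard_sdiff_singleton_of_mem hx, ENat.toENNReal_sub]
    simp
  have hinner : ∀ ω, ∫⁻ x in B, H (∫⁻ y in {x}ᶜ, s y ∂hp.kernel ω) ∂hp.kernel ω =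
      N ω * H (Y ω + v * (N ω - 1)) := by
    intro ω
    rw [hp.setLIntegral_kernel ω hB, tsum_congr fun x : ↥(Φ ω ∩ B) =>
      congrArg H (hsplit' ω x x.2), ENNReal.tsum_const,
      show N ω = _ from hp.kernel_apply ω hB]
    rfl
  have hindep : P.map (fun ω => (Y ω, N ω)) = (P.map Y).prod (P.map N) :=
    (indepFun_iff_map_prod_eq_prod_map_map hY.aemeasurable hN.aemeasurable).1
      (h.indepFun_lintegral_compl s hB)
  have hlaw : P.map N = (poissonMeasure (Λ B).toNNReal).map (Nat.cast : ℕ → ℝ≥0∞) := by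
    have : N = (fun n : ℕ∞ => (n : ℝ≥0∞)) ∘ pointCount Φ B := by
      ext ω
      exact hp.kernel_apply ω hB
    rw [this, ← Measure.map_map .of_discrete (h.measurable_count B hB), h.map_pointCount hB hΛ,
      Measure.map_map .of_discrete .of_discrete]
    congr 1
  -- By independence, the count in `B` may be replaced by a separate Poisson variable, to which the
  -- shift identity applies.
  have hlint : ∀ F : ℝ≥0∞ × ℝ≥0∞ → ℝ≥0∞, Measurable F → ∫⁻ ω, F (Y ω, N ω) ∂P =
      ∫⁻ ω, ∫⁻ n : ℕ, F (Y ω, n) ∂poissonMeasure (Λ B).toNNReal ∂P := by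
    intro F hF
    have hprobN : IsProbabilityMeasure (P.map N) :=
      Measure.isProbabilityMeasure_map hN.aemeasurable
    rw [← lintegral_map (g := fun ω => (Y ω, N ω)) hF (hY.prodMk hN), hindep,
      lintegral_prod _ hF.aemeasurable, lintegral_map hF.lintegral_prod_right' hY]
    simp_rw [hlaw]
    refine lintegral_congr fun ω => ?_
    rw [lintegral_map (by fun_prop) .of_discrete]
  simp_rw [hinner, hsplit]
  rw [hlint (fun p => p.2 * H (p.1 + v * (p.2 - 1))) (by fun_prop),
    hlint (fun p => H (p.1 + v * p.2)) (by fun_prop)]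
  have hshift := fun ω => lintegral_poissonMeasure_shift (Λ B).toNNReal
    fun n => H (Y ω + v * n)
  -- Subtraction is truncated on both sides of the cast, so the two agree also at `n = 0`.
  simp only [ENNReal.natCast_sub, Nat.cast_one] at hshift
  simp_rw [hshift]
  rw [lintegral_const_mul' _ _ ENNReal.coe_ne_top, ENNReal.coe_toNNReal hΛ]


/-- Cut `B` along the fibres of `s` and add up the formula over the pieces. -/
theorem lintegral_simpleFunc [SecondCountableTopology E] [IsProbabilityMeasure P]
    (h : IsPoissonProcess Φ Λ P) (s : SimpleFunc E ℝ≥0∞) {B : Set E} (hB : MeasurableSet B)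
    (hΛ : Λ B ≠ ∞) {H : ℝ≥0∞ → ℝ≥0∞} (hH : Measurable H) :
    ∫⁻ ω, ∫⁻ x in B, H (∫⁻ y in {x}ᶜ, s y ∂h.isRandomPointSet.kernel ω)
        ∂h.isRandomPointSet.kernel ω ∂P =
      Λ B * ∫⁻ ω, H (∫⁻ y, s y ∂h.isRandomPointSet.kernel ω) ∂P := by
  have hp := h.isRandomPointSet
  have hm : ∀ v ∈ s.range, MeasurableSet (B ∩ s ⁻¹' {v}) :=
    fun v _ => hB.inter (s.measurableSet_fiber v)
  have hd : PairwiseDisjoint (s.range : Set ℝ≥0∞) fun v => B ∩ s ⁻¹' {v} := fun v _ w _ hvw =>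
    ((disjoint_singleton.2 hvw).preimage s).mono inter_subset_right inter_subset_right
  have hU : B = ⋃ v ∈ s.range, B ∩ s ⁻¹' {v} := by
    ext x
    simp
  have hJ : Measurable fun p : Ω × E => H (∫⁻ y in {p.2}ᶜ, s y ∂hp.kernel p.1) :=
    hH.comp (hp.measurable_lintegral_compl measurable_id (f := fun q => s q.2)
      (s.measurable.comp measurable_snd))
  have hinner : ∀ ω, ∫⁻ x in B, H (∫⁻ y in {x}ᶜ, s y ∂hp.kernel ω) ∂hp.kernel ω =
      ∑ v ∈ s.range, ∫⁻ x in B ∩ s ⁻¹' {v}, H (∫⁻ y in {x}ᶜ, s y ∂hp.kernel ω)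
        ∂hp.kernel ω := by
    intro ω
    conv_lhs => rw [hU]
    exact lintegral_biUnion_finset hd hm _
  have hΛB : Λ B = ∑ v ∈ s.range, Λ (B ∩ s ⁻¹' {v}) := by
    conv_lhs => rw [hU]
    exact measure_biUnion_finset hd hm
  simp_rw [hinner]
  rw [lintegral_finsetSum, hΛB, Finset.sum_mul]
  · refine Finset.sum_congr rfl fun v hv => ?_
    exact h.lintegral_simpleFunc_fiber s (hm v hv) (measure_ne_top_of_subset inter_subset_left hΛ)
      (fun x hx => hx.2) hH
  · intro v hv
    simp_rw [← lintegral_indicator (hm v hv)]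
    refine Measurable.lintegral_kernel_prod_right' (κ := hp.kernel) (f := fun p : Ω × E =>
      (B ∩ s ⁻¹' {v}).indicator (fun x => H (∫⁻ y in {x}ᶜ, s y ∂hp.kernel p.1)) p.2) ?_
    exact hJ.indicator (measurable_snd (hm v hv))

/-- The indicator of an open upper ray is monotone and commutes with suprema, so monotone
convergence carries the formula from simple functions to `f`. Such rays suffice to identify a finite
measure of known total mass. -/
theorem lintegral_indicator_Ioi [SecondCountableTopology E] [IsProbabilityMeasure P]
    (h : IsPoissonProcess Φ Λ P) {f : E → ℝ≥0∞} (hf : Measurable f) {B : Set E}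
    (hB : MeasurableSet B) (hΛ : Λ B ≠ ∞) (a : ℝ≥0∞) :
    ∫⁻ ω, ∫⁻ x in B, (Ioi a).indicator 1 (∫⁻ y in {x}ᶜ, f y ∂h.isRandomPointSet.kernel ω)
        ∂h.isRandomPointSet.kernel ω ∂P =
      Λ B * ∫⁻ ω, (Ioi a).indicator 1 (∫⁻ y, f y ∂h.isRandomPointSet.kernel ω) ∂P := by
  have hp := h.isRandomPointSet
  let s : ℕ → SimpleFunc E ℝ≥0∞ := SimpleFunc.eapprox f
  have hH : Measurable ((Ioi a).indicator (1 : ℝ≥0∞ → ℝ≥0∞)) :=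
    measurable_one.indicator measurableSet_Ioi
  have hHmono : Monotone ((Ioi a).indicator (1 : ℝ≥0∞ → ℝ≥0∞)) := by
    intro b c hbc
    by_cases hb : a < b
    · simp [hb, hb.trans_le hbc]
    · simp [hb]
  have hHsup : ∀ b : ℕ → ℝ≥0∞, (Ioi a).indicator (1 : ℝ≥0∞ → ℝ≥0∞) (⨆ n, b n) =
      ⨆ n, (Ioi a).indicator (1 : ℝ≥0∞ → ℝ≥0∞) (b n) := by
    intro b
    refine le_antisymm ?_ (iSup_le fun n => hHmono (le_iSup b n))
    by_cases hb : a < ⨆ n, b n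
    · obtain ⟨n, hn⟩ := lt_iSup_iff.1 hb
      refine le_trans ?_ (le_iSup _ n)
      simp [hn, hb]
    · simp [hb]
  have hsup : ∀ ν : Measure E, ∫⁻ y, f y ∂ν = ⨆ n, ∫⁻ y, s n y ∂ν := by
    intro ν
    rw [← lintegral_iSup (fun n => (s n).measurable)
      (fun i j hij => SimpleFunc.monotone_eapprox f hij)]
    simp_rw [s, SimpleFunc.iSup_eapprox_apply hf]
  have hsmono : ∀ ν : Measure E, Monotone fun n => ∫⁻ y, s n y ∂ν := fun ν i j hij =>
    lintegral_mono fun y => SimpleFunc.monotone_eapprox f hij y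
  have hJ : ∀ n, Measurable fun p : Ω × E =>
      (Ioi a).indicator (1 : ℝ≥0∞ → ℝ≥0∞) (∫⁻ y in {p.2}ᶜ, s n y ∂hp.kernel p.1) := fun n =>
    hH.comp (hp.measurable_lintegral_compl measurable_id (f := fun q => s n q.2)
      ((s n).measurable.comp measurable_snd))
  simp_rw [hsup, hHsup]
  rw [lintegral_iSup (f := fun n ω =>
      (Ioi a).indicator (1 : ℝ≥0∞ → ℝ≥0∞) (∫⁻ y, s n y ∂hp.kernel ω))
    (fun n => hH.comp ((s n).measurable.lintegral_kernel))
    fun i j hij ω => hHmono (hsmono _ hij), ENNReal.mul_iSup]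
  have hin : ∀ ω, ∫⁻ x in B, ⨆ n, (Ioi a).indicator (1 : ℝ≥0∞ → ℝ≥0∞)
      (∫⁻ y in {x}ᶜ, s n y ∂hp.kernel ω) ∂hp.kernel ω = ⨆ n, ∫⁻ x in B,
      (Ioi a).indicator (1 : ℝ≥0∞ → ℝ≥0∞)
        (∫⁻ y in {x}ᶜ, s n y ∂hp.kernel ω) ∂hp.kernel ω := fun ω =>
    lintegral_iSup (fun n => (hJ n).comp measurable_prodMk_left)
      fun i j hij x => hHmono (hsmono _ hij)
  simp_rw [hin]
  rw [lintegral_iSup]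
  · exact iSup_congr fun n => h.lintegral_simpleFunc (s n) hB hΛ hH
  · intro n
    simp_rw [← lintegral_indicator hB]
    refine Measurable.lintegral_kernel_prod_right' (κ := hp.kernel) (f := fun p : Ω × E =>
      B.indicator (fun x => (Ioi a).indicator (1 : ℝ≥0∞ → ℝ≥0∞)
        (∫⁻ y in {x}ᶜ, s n y ∂hp.kernel p.1)) p.2) ?_
    exact (hJ n).indicator (measurable_snd hB)
  · exact fun i j hij ω => lintegral_mono fun x => hHmono (hsmono _ hij)

/-- **Mecke formula** for functionals of a point of the process and of the sum of `f` over the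
other points. -/
theorem mecke [SecondCountableTopology E] [IsProbabilityMeasure P] [SigmaFinite Λ]
    (h : IsPoissonProcess Φ Λ P) {f : E → ℝ≥0∞} (hf : Measurable f) {G : E × ℝ≥0∞ → ℝ≥0∞}
    (hG : Measurable G) :
    ∫⁻ ω, ∫⁻ x, G (x, ∫⁻ y in {x}ᶜ, f y ∂h.isRandomPointSet.kernel ω)
        ∂h.isRandomPointSet.kernel ω ∂P =
      ∫⁻ x, ∫⁻ ω, G (x, ∫⁻ y, f y ∂h.isRandomPointSet.kernel ω) ∂P ∂Λ := by
  have hp := h.isRandomPointSet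
  let J : Ω × E → E × ℝ≥0∞ := fun p => (p.2, ∫⁻ y in {p.2}ᶜ, f y ∂hp.kernel p.1)
  have hJ : Measurable J := measurable_snd.prodMk
    (hp.measurable_lintegral_compl measurable_id (f := fun q => f q.2) (hf.comp measurable_snd))
  let I : Ω → ℝ≥0∞ := fun ω => ∫⁻ y, f y ∂hp.kernel ω
  have hI : Measurable I := hf.lintegral_kernel
  let C : Set (Set E) := {B | MeasurableSet B ∧ Λ B ≠ ∞}
  have hprobI : IsProbabilityMeasure (P.map I) := Measure.isProbabilityMeasure_map hI.aemeasurable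
  have hJapply : ∀ B T, MeasurableSet B → MeasurableSet T →
      (P ⊗ₘ hp.kernel).map J (B ×ˢ T) =
        ∫⁻ ω, ∫⁻ x in B, T.indicator 1 (∫⁻ y in {x}ᶜ, f y ∂hp.kernel ω) ∂hp.kernel ω ∂P := by
    intro B T hB hT
    rw [← lintegral_indicator_one (hB.prod hT),
      lintegral_map (measurable_one.indicator (hB.prod hT)) hJ,
      Measure.lintegral_compProd (f := fun p => (B ×ˢ T).indicator 1 (J p))
        ((measurable_one.indicator (hB.prod hT)).comp hJ)]
    refine lintegral_congr fun ω => ?_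
    rw [← lintegral_indicator hB]
    refine lintegral_congr fun x => ?_
    dsimp only [J]
    rw [indicator_prod_one]
    by_cases hx : x ∈ B <;> simp [hx]
  have hrect : ∀ B ∈ C, ∀ T, MeasurableSet T →
      (P ⊗ₘ hp.kernel).map J (B ×ˢ T) = Λ B * P.map I T := by
    rintro B ⟨hB, hΛ⟩ T hT
    -- For fixed `B`, both sides are measures in `T`; they agree on rays and in total mass.
    let m₁ : Measure ℝ≥0∞ := (((P ⊗ₘ hp.kernel).map J).restrict (B ×ˢ univ)).map Prod.snd
    have hm₁ : ∀ T, MeasurableSet T → m₁ T = (P ⊗ₘ hp.kernel).map J (B ×ˢ T) := by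
      intro T hT
      rw [Measure.map_apply measurable_snd hT, Measure.restrict_apply (measurable_snd hT)]
      congr 1
      ext x
      simp [and_comm]
    have huniv : m₁ univ = Λ B := by
      rw [hm₁ _ .univ, hJapply _ _ hB .univ]
      -- With `H = 1` the formula says that the mean count in `B` is `Λ B`.
      have := h.lintegral_simpleFunc 0 hB hΛ (H := 1) measurable_one
      simpa using this
    have hIoi : ∀ a, m₁ (Ioi a) = (Λ B • P.map I) (Ioi a) := by
      intro a
      rw [hm₁ _ measurableSet_Ioi, hJapply _ _ hB measurableSet_Ioi,
        h.lintegral_indicator_Ioi hf hB hΛ, Measure.smul_apply, smul_eq_mul,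
        ← lintegral_map (g := I) (measurable_one.indicator measurableSet_Ioi) hI,
        lintegral_indicator_one measurableSet_Ioi]
    have hfin : IsFiniteMeasure m₁ := ⟨by rw [huniv]; exact hΛ.lt_top⟩
    have hfin' : IsFiniteMeasure (Λ B • P.map I) :=
      ⟨by rw [Measure.smul_apply, measure_univ]; simpa using hΛ.lt_top⟩
    have : m₁ = Λ B • P.map I := by
      refine Measure.ext_of_Iic _ _ fun a => ?_
      rw [← compl_Ioi, measure_compl measurableSet_Ioi (measure_ne_top _ _),
        measure_compl measurableSet_Ioi (measure_ne_top _ _), hIoi, huniv]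
      simp
    rw [← hm₁ T hT, this, Measure.smul_apply, smul_eq_mul]
  have hC : MeasurableSpace.generateFrom C = (inferInstance : MeasurableSpace E) := by
    refine le_antisymm (MeasurableSpace.generateFrom_le fun B hB => hB.1) fun B hB => ?_
    have : B = ⋃ n, B ∩ spanningSets Λ n := by
      rw [← inter_iUnion, iUnion_spanningSets, inter_univ]
    rw [this]
    refine MeasurableSet.iUnion fun n => MeasurableSpace.measurableSet_generateFrom
      ⟨hB.inter (measurableSet_spanningSets Λ n), ?_⟩
    exact measure_ne_top_of_subset inter_subset_right (measure_spanningSets_lt_top Λ n).ne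
  have hpi : IsPiSystem C := fun s hs t ht _ =>
    ⟨hs.1.inter ht.1, measure_ne_top_of_subset inter_subset_left hs.2⟩
  have hprod : Λ.prod (P.map I) = (P ⊗ₘ hp.kernel).map J :=
    Measure.prod_eq_generateFrom hC MeasurableSpace.generateFrom_measurableSet hpi
      MeasurableSpace.isPiSystem_measurableSet
      ⟨spanningSets Λ, fun n => ⟨measurableSet_spanningSets Λ n,
        (measure_spanningSets_lt_top Λ n).ne⟩, measure_spanningSets_lt_top Λ,
        iUnion_spanningSets Λ⟩
      ⟨fun _ => univ, fun _ => MeasurableSet.univ, fun _ => measure_lt_top _ _, iUnion_const _⟩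
      fun s hs t ht => hrect s hs t ht
  calc _ = ∫⁻ p, G (J p) ∂(P ⊗ₘ hp.kernel) := (Measure.lintegral_compProd (hG.comp hJ)).symm
    _ = ∫⁻ q, G q ∂(Λ.prod (P.map I)) := by rw [hprod, lintegral_map hG hJ]
    _ = _ := by
      rw [lintegral_prod _ hG.aemeasurable]
      refine lintegral_congr fun x => ?_
      rw [lintegral_map (by fun_prop) hI]

/-- **Campbell's formula**. -/
theorem campbell [SecondCountableTopology E] [IsProbabilityMeasure P] [SigmaFinite Λ]
    (h : IsPoissonProcess Φ Λ P) {g : E → ℝ≥0∞} (hg : Measurable g) :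
    ∫⁻ ω, ∫⁻ x, g x ∂h.isRandomPointSet.kernel ω ∂P = ∫⁻ x, g x ∂Λ := by
  simpa using h.mecke (f := 0) measurable_zero (G := fun p => g p.1) (hg.comp measurable_fst)

theorem lintegral_kernel_measure [SecondCountableTopology E] [IsProbabilityMeasure P]
    [SigmaFinite Λ] (h : IsPoissonProcess Φ Λ P) {B : Set E} (hB : MeasurableSet B) :
    ∫⁻ ω, h.isRandomPointSet.kernel ω B ∂P = Λ B := by
  simpa [lintegral_indicator_one hB] using h.campbell (measurable_one.indicator hB)

/-- Campbell's formula for an integrand depending on a random element independent of the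
process. -/
theorem campbell_of_indepFun [SecondCountableTopology E] [IsProbabilityMeasure P] [SigmaFinite Λ]
    (h : IsPoissonProcess Φ Λ P) {X : Type*} {mX : MeasurableSpace X} {Z : Ω → X} (hZ : Measurable Z)
    (hind : IndepFun Z (countFamily Φ) P) {g : E × X → ℝ≥0∞} (hg : Measurable g) :
    ∫⁻ ω, ∫⁻ x, g (x, Z ω) ∂h.isRandomPointSet.kernel ω ∂P =
      ∫⁻ x, ∫⁻ ω, g (x, Z ω) ∂P ∂Λ := by
  have hp := h.isRandomPointSet
  let J : Ω × E → E × X := fun p => (p.2, Z p.1)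
  have hJ : Measurable J := measurable_snd.prodMk (hZ.comp measurable_fst)
  have hprobZ : IsProbabilityMeasure (P.map Z) := Measure.isProbabilityMeasure_map hZ.aemeasurable
  have hprod : Λ.prod (P.map Z) = (P ⊗ₘ hp.kernel).map J := by
    refine Measure.prod_eq fun B T hB hT => ?_
    have hindB : IndepFun (fun ω => T.indicator (1 : X → ℝ≥0∞) (Z ω))
        (fun ω => hp.kernel ω B) P := by
      have := hind.comp (φ := T.indicator (1 : X → ℝ≥0∞))
        (ψ := fun c : {B : Set E // MeasurableSet B} → ℕ∞ => (c ⟨B, hB⟩ : ℝ≥0∞))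
        (measurable_one.indicator hT) (Measurable.of_discrete.comp (measurable_pi_apply _))
      exact this.congr (.of_forall fun ω => rfl) (.of_forall fun ω => (hp.kernel_apply ω hB).symm)
    rw [← lintegral_indicator_one (hB.prod hT),
      lintegral_map (measurable_one.indicator (hB.prod hT)) hJ,
      Measure.lintegral_compProd (f := fun p => (B ×ˢ T).indicator 1 (J p))
        ((measurable_one.indicator (hB.prod hT)).comp hJ)]
    have hin : ∀ ω, ∫⁻ x, (B ×ˢ T).indicator (1 : E × X → ℝ≥0∞) (J (ω, x)) ∂hp.kernel ω =
        ((fun ω => T.indicator (1 : X → ℝ≥0∞) (Z ω)) * fun ω => hp.kernel ω B) ω := by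
      intro ω
      by_cases hω : Z ω ∈ T
      · rw [Pi.mul_apply, indicator_of_mem hω, Pi.one_apply, one_mul,
          ← lintegral_indicator_one hB]
        refine lintegral_congr fun x => ?_
        dsimp only [J]
        rw [indicator_prod_one]
        simp [hω]
      · dsimp only [J]
        simp [hω]
    simp_rw [hin]
    rw [lintegral_mul_eq_lintegral_mul_lintegral_of_indepFun
      (f := fun ω => T.indicator (1 : X → ℝ≥0∞) (Z ω))
      ((measurable_one.indicator hT).comp hZ) (Kernel.measurable_coe _ hB) hindB,
      h.lintegral_kernel_measure hB, mul_comm,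
      ← lintegral_map (measurable_one.indicator hT) hZ, lintegral_indicator_one hT]
  calc _ = ∫⁻ p, g (J p) ∂(P ⊗ₘ hp.kernel) := (Measure.lintegral_compProd (hg.comp hJ)).symm
    _ = ∫⁻ q, g q ∂(Λ.prod (P.map Z)) := by rw [hprod, lintegral_map hg hJ]
    _ = _ := by
      rw [lintegral_prod _ hg.aemeasurable]
      refine lintegral_congr fun x => ?_
      rw [lintegral_map (by fun_prop) hZ]

end IsPoissonProcess

/-! ### Thinning of the RRHs -/

namespace CRAN

variable {Ω : Type*} (N : CRAN Ω)

/-- Attaching the mark is injective, so thinning amounts to counting marked points in a product set;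
all properties of the active process are read off from this. -/
theorem pointCount_activeRRH (μ : ℝ) (B : Set Plane) (ω : Ω) :
    pointCount (N.activeRRH μ) B ω =
      pointCount N.markedRRH (B ×ˢ {m : unitInterval | (m : ℝ) ≤ μ}) ω := by
  have hinj : Function.Injective fun x : Plane => (x, N.mark ω x) :=
    fun x y hxy => congrArg Prod.fst hxy
  rw [pointCount, pointCount, ← hinj.encard_image]
  congr 1
  ext ⟨x, m⟩
  simp only [activeRRH, markedRRH, mem_image, mem_inter_iff, mem_ofPred_eq, Prod.mk.injEq,
    mem_prod]
  constructor
  · rintro ⟨y, ⟨⟨hy, hm⟩, hB⟩, rfl, rfl⟩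
    exact ⟨⟨y, hy, rfl, rfl⟩, hB, hm⟩
  · rintro ⟨⟨y, hy, rfl, rfl⟩, hB, hm⟩
    exact ⟨y, ⟨⟨hy, hm⟩, hB⟩, rfl, rfl⟩

theorem measurableSet_mark_le (μ : ℝ) : MeasurableSet {m : unitInterval | (m : ℝ) ≤ μ} :=
  measurableSet_le measurable_subtype_coe measurable_const

theorem volume_mark_le {μ : ℝ} (hμ : μ ∈ Icc (0 : ℝ) 1) :
    volume {m : unitInterval | (m : ℝ) ≤ μ} = ENNReal.ofReal μ := by
  have : {m : unitInterval | (m : ℝ) ≤ μ} = Iic ⟨μ, hμ⟩ := rfl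
  rw [this, unitInterval.volume_Iic]

theorem finite_activeRRH (hf : ∀ ω, ∀ B : Set (Plane × unitInterval), Bornology.IsBounded B →
    (N.markedRRH ω ∩ B).Finite) (μ : ℝ) (ω : Ω) {B : Set Plane} (hB : Bornology.IsBounded B) :
    (N.activeRRH μ ω ∩ B).Finite := by
  have h := hf ω (B ×ˢ {m : unitInterval | (m : ℝ) ≤ μ}) (hB.prod (Bornology.IsBounded.all _))
  rw [← encard_ne_top_iff] at h ⊢
  exact (N.pointCount_activeRRH μ B ω).trans_ne h

/-- The active RRHs form a point process for every σ-algebra for which the marked RRHs do. -/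
theorem isRandomPointSet_activeRRH [MeasurableSpace Ω] (h : IsRandomPointSet N.markedRRH) (μ : ℝ) :
    IsRandomPointSet (N.activeRRH μ) where
  locallyFinite ω _ hB := N.finite_activeRRH h.locallyFinite μ ω hB
  measurable_count B hB := by
    rw [show pointCount (N.activeRRH μ) B = _ from funext (N.pointCount_activeRRH μ B)]
    exact h.measurable_count _ (hB.prod (measurableSet_mark_le μ))

/-- Independent thinning: the active RRHs form a Poisson process. -/
theorem isPoissonProcess_activeRRH [MeasurableSpace Ω] {P : Measure Ω} {lamR μ : ℝ}
    (hlamR : 0 ≤ lamR) (hμ : μ ∈ Icc (0 : ℝ) 1)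
    (h : IsPoissonProcess N.markedRRH
      (ENNReal.ofReal lamR • (volume : Measure Plane).prod (volume : Measure unitInterval)) P) :
    IsPoissonProcess (N.activeRRH μ)
      (ENNReal.ofReal (lamR * μ) • (volume : Measure Plane)) P where
  locallyFinite := (N.isRandomPointSet_activeRRH h.isRandomPointSet μ).locallyFinite
  measurable_count := (N.isRandomPointSet_activeRRH h.isRandomPointSet μ).measurable_count
  count_law B hB hΛ n := by
    have hvol : (ENNReal.ofReal (lamR * μ) • (volume : Measure Plane)) B =
        (ENNReal.ofReal lamR • (volume : Measure Plane).prod (volume : Measure unitInterval))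
          (B ×ˢ {m : unitInterval | (m : ℝ) ≤ μ}) := by
      simp only [Measure.smul_apply, smul_eq_mul, Measure.prod_prod, volume_mark_le hμ,
        ENNReal.ofReal_mul hlamR]
      ring
    rw [hvol] at hΛ ⊢
    simp_rw [N.pointCount_activeRRH]
    exact h.count_law _ (hB.prod (measurableSet_mark_le μ)) hΛ n
  indep_counts n B hB hd := by
    simp_rw [show ∀ i, pointCount (N.activeRRH μ) (B i) = _ from
      fun i => funext (N.pointCount_activeRRH μ (B i))]
    exact h.indep_counts n _ (fun i => (hB i).prod (measurableSet_mark_le μ))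
      fun i j hij => disjoint_prod.2 (Or.inl (hd hij))

end CRAN

/-! ### SIR events at thresholds of at least one -/

section SIR

variable {α : ℝ} {t : ℝ≥0∞}

theorem pathGain_le_of_dist_le (hα : 0 < α) {u x y : Plane} (h : dist u y ≤ dist u x) :
    pathGain α u x ≤ pathGain α u y := by
  rw [pathGain, pathGain, ENNReal.rpow_neg, ENNReal.rpow_neg, ENNReal.inv_le_inv]
  refine ENNReal.rpow_le_rpow ?_ hα.le
  rw [edist_dist, edist_dist]
  exact ENNReal.ofReal_le_ofReal h

/-- The interference may be `0` or `∞`; clearing the denominator remains valid because `0 < t < ∞`.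
-/
theorem lt_sirFrom_iff (ht : 1 ≤ t) (ht' : t ≠ ∞) (A : Set Plane) (u x : Plane) :
    t < sirFrom α A u x ↔ t * ∑' y : ↥(A \ {x}), pathGain α u y < pathGain α u x :=
  ENNReal.lt_div_iff_mul_lt (Or.inr ht') (Or.inr (one_pos.trans_le ht).ne')

/-- At a threshold of at least `1`, a transmitter that beats the threshold is strictly stronger
than all others. -/
theorem pathGain_lt_of_interference_lt (ht : 1 ≤ t) {A : Set Plane} {u x y : Plane}
    (h : t * ∑' y : ↥(A \ {x}), pathGain α u y < pathGain α u x) (hy : y ∈ A) (hxy : y ≠ x) :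
    pathGain α u y < pathGain α u x :=
  calc pathGain α u y ≤ ∑' y : ↥(A \ {x}), pathGain α u y :=
        ENNReal.le_tsum (f := fun y : ↥(A \ {x}) => pathGain α u y) ⟨y, hy, hxy⟩
    _ ≤ t * ∑' y : ↥(A \ {x}), pathGain α u y := le_mul_of_one_le_left' ht
    _ < _ := h

/-- The condition of being nearest is automatic: a transmitter beating `t ≥ 1` is strictly stronger
than every other one, so none is closer. -/
theorem lt_sir_iff (hα : 0 < α) (ht : 1 ≤ t) (ht' : t ≠ ∞) (A : Set Plane) (u : Plane) :
    t < sir α A u ↔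
      ∃ x ∈ A, t * ∑' y : ↥(A \ {x}), pathGain α u y < pathGain α u x := by
  simp only [sir, lt_iSup_iff, lt_sirFrom_iff ht ht']
  constructor
  · rintro ⟨x, hx, h⟩
    exact ⟨x, hx.1, h⟩
  · rintro ⟨x, hx, h⟩
    refine ⟨x, ⟨hx, fun y hy => ?_⟩, h⟩
    by_contra! hlt
    exact (pathGain_le_of_dist_le hα hlt.le).not_gt
      (pathGain_lt_of_interference_lt ht h hy fun hyx => by simp [hyx] at hlt)

theorem Measurable.pathGain {X : Type*} [MeasurableSpace X] {f g : X → Plane} (hf : Measurable f)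
    (hg : Measurable g) : Measurable fun x => pathGain α (f x) (g x) :=
  (hf.edist hg).pow_const _

variable {Ω : Type*} [MeasurableSpace Ω] {Φ : Ω → Set Plane}

/-- At a threshold of at least `1`, the indicator of the event that the SIR beats the threshold is
a sum over the transmitters. -/
theorem IsRandomPointSet.indicator_lt_sir (h : IsRandomPointSet Φ) (hα : 0 < α) (ht : 1 ≤ t)
    (ht' : t ≠ ∞) (ω : Ω) (u : Plane) :
    {ω | t < sir α (Φ ω) u}.indicator (1 : Ω → ℝ≥0∞) ω =
      ∫⁻ x, {p : Plane × ℝ≥0∞ | t * p.2 < pathGain α u p.1}.indicator 1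
        (x, ∫⁻ y in {x}ᶜ, pathGain α u y ∂h.kernel ω) ∂h.kernel ω := by
  have hI : ∀ x, ∫⁻ y in {x}ᶜ, pathGain α u y ∂h.kernel ω =
      ∑' y : ↥(Φ ω \ {x}), pathGain α u y := fun x => by
    rw [h.setLIntegral_kernel ω (measurableSet_singleton x).compl]
    rfl
  simp_rw [hI]
  rw [h.lintegral_kernel]
  by_cases hω : ω ∈ {ω | t < sir α (Φ ω) u}
  · obtain ⟨x, hx, hlt⟩ := (lt_sir_iff hα ht ht' _ _).1 hω
    rw [indicator_of_mem hω, tsum_eq_single ⟨x, hx⟩, indicator_of_mem (by exact hlt)]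
    · rfl
    · rintro ⟨y, hy⟩ hyx
      refine indicator_of_notMem (fun hlt' => ?_) _
      have hne : y ≠ x := fun h => hyx (Subtype.ext h)
      exact lt_asymm (pathGain_lt_of_interference_lt ht hlt hy hne)
        (pathGain_lt_of_interference_lt ht hlt' hx hne.symm)
  · rw [indicator_of_notMem hω, eq_comm, ENNReal.tsum_eq_zero]
    rintro ⟨x, hx⟩
    refine indicator_of_notMem (fun hlt => ?_) _
    exact hω ((lt_sir_iff hα ht ht' _ _).2 ⟨x, hx, hlt⟩)

/-- The event is where the sum over transmitters is nonzero, and that sum is jointly measurable in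
the location and the outcome. -/
theorem IsRandomPointSet.measurableSet_lt_sir (h : IsRandomPointSet Φ) (hα : 0 < α) (ht : 1 ≤ t)
    (ht' : t ≠ ∞) : MeasurableSet {p : Plane × Ω | t < sir α (Φ p.2) p.1} := by
  let S : Set (Ω × (Plane × Plane)) := {p |
    t * ∫⁻ y in {p.2.2}ᶜ, pathGain α p.2.1 y ∂h.kernel p.1 < pathGain α p.2.1 p.2.2}
  let g : Ω × (Plane × Plane) → ℝ≥0∞ := S.indicator 1
  have hg : Measurable g := by
    have hJ : Measurable fun p : Ω × (Plane × Plane) =>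
        ∫⁻ y in {p.2.2}ᶜ, pathGain α p.2.1 y ∂h.kernel p.1 :=
      h.measurable_lintegral_compl (X := Plane × Plane) (g := Prod.snd) measurable_snd
        (f := fun q : (Plane × Plane) × Plane => pathGain α q.1.1 q.2)
        (measurable_fst.fst.pathGain measurable_snd)
    exact measurable_one.indicator (measurableSet_lt (hJ.const_mul t)
      (measurable_snd.fst.pathGain measurable_snd.snd))
  have hm : Measurable fun p : Ω × Plane => ∫⁻ x, g (p.1, (p.2, x)) ∂h.kernel p.1 :=
    h.measurable_lintegral (f := fun q : (Ω × Plane) × Plane => g (q.1.1, (q.1.2, q.2)))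
      (hg.comp (measurable_fst.fst.prodMk (measurable_fst.snd.prodMk measurable_snd)))
  have hset : {p : Plane × Ω | t < sir α (Φ p.2) p.1} =
      (fun p : Plane × Ω => (p.2, p.1)) ⁻¹'
        ((fun p : Ω × Plane => ∫⁻ x, g (p.1, (p.2, x)) ∂h.kernel p.1) ⁻¹' {0}ᶜ) := by
    ext ⟨u, ω⟩
    have := h.indicator_lt_sir hα ht ht' ω u
    change _ = ∫⁻ x, g (ω, (u, x)) ∂h.kernel ω at this
    simp only [mem_preimage, mem_compl_iff, mem_singleton_iff]
    rw [← this]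
    simp
  rw [hset]
  exact measurable_swap (hm (measurableSet_singleton 0).compl)

end SIR

/-! ### Tail of the SIR -/

theorem sigmaFinite_smul_of_ne_top {E : Type*} [MeasurableSpace E] (ν : Measure E) [SigmaFinite ν]
    {c : ℝ≥0∞} (hc : c ≠ ∞) : SigmaFinite (c • ν) := by
  lift c to NNReal using hc
  exact inferInstanceAs (SigmaFinite (c • ν))

theorem pathGain_sub (α : ℝ) (u v : Plane) : pathGain α u (u - v) = ‖v‖ₑ ^ (-α) := by
  rw [pathGain, edist_eq_enorm_sub, sub_sub_cancel]

/-- Dividing the gain by `t` is a dilation by `t^(1/α)`, which in the plane scales area by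
`t^(2/α)`: the source of the Pareto exponent. -/
theorem enorm_rpow_neg_smul {α t : ℝ} (hα : 0 < α) (ht : 0 < t) (v : Plane) :
    ‖t ^ (1 / α) • v‖ₑ ^ (-α) = ‖v‖ₑ ^ (-α) / ENNReal.ofReal t := by
  have ht' : 0 < t ^ (1 / α) := Real.rpow_pos_of_pos ht _
  have h1 : ENNReal.ofReal (t ^ (1 / α)) ^ α = ENNReal.ofReal t := by
    rw [ENNReal.ofReal_rpow_of_pos ht', ← Real.rpow_mul ht.le, one_div_mul_cancel hα.ne',
      Real.rpow_one]
  rw [enorm_smul, Real.enorm_of_nonneg ht'.le, ENNReal.rpow_neg,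
    ENNReal.mul_rpow_of_nonneg _ _ hα.le, h1, ENNReal.mul_inv (Or.inl (by simpa using ht)) (Or.inl ENNReal.ofReal_ne_top),
    ENNReal.rpow_neg, mul_comm, div_eq_mul_inv]

theorem lintegral_comp_smul_plane {c : ℝ} (hc : 0 < c) {f : Plane → ℝ≥0∞} (hf : Measurable f) :
    ∫⁻ v, f (c • v) = ENNReal.ofReal ((c ^ 2)⁻¹) * ∫⁻ v, f v := by
  rw [← lintegral_map hf (measurable_const_smul c), Measure.map_addHaar_smul _ hc.ne',
    lintegral_smul_measure, finrank_euclideanSpace_fin, abs_of_pos (by positivity), smul_eq_mul]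

namespace IsPoissonProcess

variable {Ω : Type*} [MeasurableSpace Ω] {Φ : Ω → Set Plane} {P : Measure Ω}
  [IsProbabilityMeasure P] {α : ℝ}

/-- The probability is the mean number of transmitters beating the threshold. By the Mecke formula,
the interference seen by such a transmitter becomes the power of the whole process. -/
theorem measure_lt_sir {Λ : Measure Plane} [SigmaFinite Λ] (h : IsPoissonProcess Φ Λ P)
    (hα : 0 < α) {t : ℝ≥0∞} (ht : 1 ≤ t) (ht' : t ≠ ∞) (u : Plane) :
    P {ω | t < sir α (Φ ω) u} =
      ∫⁻ x, P {ω | ∫⁻ y, pathGain α u y ∂h.isRandomPointSet.kernel ω < pathGain α u x / t} ∂Λ := by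
  have hp := h.isRandomPointSet
  have hpg : Measurable (pathGain α u) := measurable_const.pathGain measurable_id
  have hI : Measurable fun ω => ∫⁻ y, pathGain α u y ∂hp.kernel ω := hpg.lintegral_kernel
  have hs : MeasurableSet {p : Plane × ℝ≥0∞ | t * p.2 < pathGain α u p.1} :=
    measurableSet_lt (measurable_snd.const_mul t) (hpg.comp measurable_fst)
  have hC : MeasurableSet {ω | t < sir α (Φ ω) u} :=
    measurable_prodMk_left (hp.measurableSet_lt_sir hα ht ht')
  rw [← lintegral_indicator_one hC]
  simp_rw [hp.indicator_lt_sir hα ht ht']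
  rw [h.mecke hpg (measurable_one.indicator hs)]
  refine lintegral_congr fun x => ?_
  rw [← lintegral_indicator_one (measurableSet_lt hI measurable_const)]
  refine lintegral_congr fun ω => ?_
  have : t * ∫⁻ y, pathGain α u y ∂hp.kernel ω < pathGain α u x ↔
      ∫⁻ y, pathGain α u y ∂hp.kernel ω < pathGain α u x / t := by
    rw [ENNReal.lt_div_iff_mul_lt (Or.inl (one_pos.trans_le ht).ne') (Or.inl ht'), mul_comm]
  simp only [indicator, mem_ofPred_eq, this, Pi.one_apply]

theorem measure_lt_sir_ball {c : ℝ≥0∞} (hc : c ≠ ∞)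
    (h : IsPoissonProcess Φ (c • (volume : Measure Plane)) P) (hα : 0 < α) {t : ℝ} (ht : 1 ≤ t)
    (u : Plane) : P {ω | ENNReal.ofReal t < sir α (Φ ω) u} =
      c * ∫⁻ v : Plane, P {ω | ∫⁻ y, pathGain α u y ∂h.isRandomPointSet.kernel ω <
        ‖v‖ₑ ^ (-α) / ENNReal.ofReal t} := by
  have := sigmaFinite_smul_of_ne_top (volume : Measure Plane) hc
  rw [h.measure_lt_sir hα (by simpa using ht) ENNReal.ofReal_ne_top, lintegral_smul_measure,
    ← lintegral_sub_left_eq_self _ u, smul_eq_mul]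
  simp_rw [pathGain_sub]

/-- The SIR has a Pareto tail above the threshold `1`. -/
theorem measure_lt_sir_eq_rpow {c : ℝ≥0∞} (hc : c ≠ ∞)
    (h : IsPoissonProcess Φ (c • (volume : Measure Plane)) P) (hα : 0 < α) {t : ℝ} (ht : 1 ≤ t)
    (u : Plane) : P {ω | ENNReal.ofReal t < sir α (Φ ω) u} =
      ENNReal.ofReal (t ^ (-(2 / α))) * P {ω | 1 < sir α (Φ ω) u} := by
  have ht0 : 0 < t := one_pos.trans_le ht
  let ψ : Plane → ℝ≥0∞ := fun v =>
    P {ω | ∫⁻ y, pathGain α u y ∂h.isRandomPointSet.kernel ω < ‖v‖ₑ ^ (-α)}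
  have hψ : Measurable ψ := by
    have hmono : Monotone fun r : ℝ≥0∞ =>
        P {ω | ∫⁻ y, pathGain α u y ∂h.isRandomPointSet.kernel ω < r} := fun r s hrs =>
      measure_mono fun ω hω => lt_of_lt_of_le hω hrs
    exact hmono.measurable.comp (measurable_enorm.pow_const _)
  have h1 := h.measure_lt_sir_ball hc hα le_rfl u
  rw [ENNReal.ofReal_one] at h1
  simp_rw [div_one] at h1
  rw [h1, h.measure_lt_sir_ball hc hα ht]
  simp_rw [← enorm_rpow_neg_smul hα ht0]
  rw [lintegral_comp_smul_plane (Real.rpow_pos_of_pos ht0 _) hψ, mul_left_comm]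
  congr 2
  rw [← Real.rpow_natCast, ← Real.rpow_mul ht0.le, ← Real.rpow_neg ht0.le]
  congr 2
  push_cast
  ring

/-- Near `u` there are finitely many points, almost surely none at `u` itself. Far away the mean
power is finite by Campbell's formula, because `α > 2` is integrable at infinity in the plane. -/
theorem ae_lintegral_pathGain_lt_top {c : ℝ≥0∞} (hc : c ≠ ∞)
    (h : IsPoissonProcess Φ (c • (volume : Measure Plane)) P) (hα : 2 < α) (u : Plane) :
    ∀ᵐ ω ∂P, ∫⁻ y, pathGain α u y ∂h.isRandomPointSet.kernel ω < ∞ := by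
  have hp := h.isRandomPointSet
  have := sigmaFinite_smul_of_ne_top (volume : Measure Plane) hc
  have hpg : Measurable (pathGain α u) := measurable_const.pathGain measurable_id
  let K : Set Plane := Metric.closedBall u 1
  have hK : MeasurableSet K := measurableSet_closedBall
  have hu : ∀ᵐ ω ∂P, hp.kernel ω {u} = 0 := by
    refine (lintegral_eq_zero_iff (Kernel.measurable_coe _ (measurableSet_singleton u))).1 ?_
    rw [h.lintegral_kernel_measure (measurableSet_singleton u)]
    simp
  have hfar : ∀ᵐ ω ∂P, ∫⁻ y in Kᶜ, pathGain α u y ∂hp.kernel ω < ∞ := by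
    simp_rw [← lintegral_indicator hK.compl]
    refine ae_lt_top (hpg.indicator hK.compl).lintegral_kernel ?_
    rw [h.campbell (hpg.indicator hK.compl), lintegral_smul_measure, smul_eq_mul]
    -- Outside the unit ball the distance `r` satisfies `1 + r ≤ 2 r`, which gives the constant `2 ^
    -- α`.
    refine ENNReal.mul_ne_top hc (ne_top_of_le_ne_top ?_ (lintegral_mono
      (g := fun y => ENNReal.ofReal (2 ^ α) * ENNReal.ofReal ((1 + ‖u - y‖) ^ (-α))) ?_))
    · rw [lintegral_const_mul' _ _ ENNReal.ofReal_ne_top,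
        lintegral_sub_left_eq_self (fun v : Plane => ENNReal.ofReal ((1 + ‖v‖) ^ (-α)))]
      exact ENNReal.mul_ne_top ENNReal.ofReal_ne_top
        (finite_integral_one_add_norm (by simpa using hα)).ne
    · intro y
      by_cases hy : y ∈ K
      · simp [hy]
      · have hy1 : 1 < ‖u - y‖ := by
          simpa [K, dist_eq_norm, norm_sub_rev] using hy
        have hy0 : 0 < ‖u - y‖ := one_pos.trans hy1
        simp only
        rw [indicator_of_mem hy, pathGain, edist_dist, dist_eq_norm,
          ENNReal.ofReal_rpow_of_pos hy0, ← ENNReal.ofReal_mul (by positivity)]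
        refine ENNReal.ofReal_le_ofReal ?_
        rw [Real.rpow_neg hy0.le, Real.rpow_neg (by positivity), ← div_eq_mul_inv, inv_eq_one_div,
          div_le_div_iff₀ (by positivity) (by positivity), one_mul,
          ← Real.mul_rpow (by norm_num) hy0.le]
        exact Real.rpow_le_rpow (by positivity) (by linarith) (by linarith)
  filter_upwards [hu, hfar] with ω hω hfarω
  rw [← lintegral_add_compl _ hK]
  refine ENNReal.add_lt_top.2 ⟨?_, hfarω⟩
  rw [hp.setLIntegral_kernel ω hK]
  have : Finite ↥(Φ ω ∩ K) := (h.locallyFinite ω K Metric.isBounded_closedBall).to_subtype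
  have := Fintype.ofFinite ↥(Φ ω ∩ K)
  rw [tsum_fintype]
  refine ENNReal.sum_lt_top.2 fun y _ => ?_
  have hne : u ≠ y := by
    intro huy
    have hmem : u ∈ Φ ω := huy ▸ y.2.1
    rw [hp.kernel_apply ω (measurableSet_singleton _)] at hω
    simp [pointCount, hmem] at hω
  rw [pathGain, ENNReal.rpow_neg, lt_top_iff_ne_top, ENNReal.inv_ne_top]
  exact (ENNReal.rpow_pos (edist_pos.2 hne) (edist_ne_top _ _)).ne'

/-- The total power is below some `n` with positive probability, and the gain exceeds `n` on a
nonempty open set of transmitter positions. -/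
theorem measure_one_lt_sir_pos {c : ℝ≥0∞} (hc : c ≠ ∞) (hc0 : c ≠ 0)
    (h : IsPoissonProcess Φ (c • (volume : Measure Plane)) P) (hα : 2 < α) (u : Plane) :
    P {ω | 1 < sir α (Φ ω) u} ≠ 0 := by
  have h1 := h.measure_lt_sir_ball hc (by linarith : 0 < α) le_rfl u
  rw [ENNReal.ofReal_one] at h1
  simp_rw [div_one] at h1
  rw [h1]
  let I : Ω → ℝ≥0∞ := fun ω => ∫⁻ y, pathGain α u y ∂h.isRandomPointSet.kernel ω
  obtain ⟨n, hn⟩ : ∃ n : ℕ, P {ω | I ω < n} ≠ 0 := by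
    by_contra! hcon
    have hae := h.ae_lintegral_pathGain_lt_top hc hα u
    have hnull : P {ω | I ω < ∞} = 0 := by
      refine measure_mono_null (fun ω hω => ?_) (measure_iUnion_null hcon)
      obtain ⟨n, hn⟩ := ENNReal.exists_nat_gt (ne_of_lt hω)
      exact mem_iUnion.2 ⟨n, hn⟩
    obtain ⟨ω, hω, hω'⟩ := (hae.and (measure_eq_zero_iff_ae_notMem.1 hnull)).exists
    exact hω' hω
  let V : Set Plane := {v | (n : ℝ≥0∞) < ‖v‖ₑ ^ (-α)}
  have hV : IsOpen V :=
    isOpen_lt continuous_const (ENNReal.continuous_rpow_const.comp continuous_enorm)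
  -- The origin belongs to `V` because a negative power of `0` is `∞`.
  have hVne : V.Nonempty := ⟨0, by
    have : (0 : ℝ≥0∞) ^ (-α) = ∞ := ENNReal.zero_rpow_of_neg (by linarith)
    simp [V, this]⟩
  refine mul_ne_zero hc0 (ne_of_gt (lt_of_lt_of_le ?_ (setLIntegral_le_lintegral V _)))
  refine lt_of_lt_of_le ?_ (setLIntegral_mono' (f := fun _ => P {ω | I ω < n}) hV.measurableSet
    fun v hv => measure_mono fun ω (hω : I ω < n) => show I ω < ‖v‖ₑ ^ (-α) from hω.trans hv)
  rw [setLIntegral_const]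
  exact pos_iff_ne_zero.2 (mul_ne_zero hn (hV.measure_pos volume hVne).ne')

/-- The Pareto tail vanishes at infinity. This matters because `toReal` sends `∞` to `0`. -/
theorem measure_sir_eq_top {c : ℝ≥0∞} (hc : c ≠ ∞)
    (h : IsPoissonProcess Φ (c • (volume : Measure Plane)) P) (hα : 0 < α) (u : Plane) :
    P {ω | sir α (Φ ω) u = ∞} = 0 := by
  have hle : ∀ᶠ t : ℝ in Filter.atTop,
      P {ω | sir α (Φ ω) u = ∞} ≤ ENNReal.ofReal (t ^ (-(2 / α))) := by
    filter_upwards [Filter.eventually_ge_atTop 1] with t ht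
    calc P {ω | sir α (Φ ω) u = ∞} ≤ P {ω | ENNReal.ofReal t < sir α (Φ ω) u} :=
          measure_mono fun ω (hω : _ = ∞) => by
            simp [hω]
      _ ≤ ENNReal.ofReal (t ^ (-(2 / α))) * 1 := by
          rw [h.measure_lt_sir_eq_rpow hc hα ht]
          gcongr
          exact prob_le_one
      _ = _ := mul_one _
  have hlim : Filter.Tendsto (fun t : ℝ => ENNReal.ofReal (t ^ (-(2 / α)))) Filter.atTop
      (nhds 0) := by
    have := ENNReal.tendsto_ofReal (tendsto_rpow_neg_atTop (by positivity : 0 < 2 / α))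
    simpa using this
  exact le_antisymm (ge_of_tendsto hlim hle) zero_le

end IsPoissonProcess

/-! ### Mean spectral efficiency on the coverage event -/

theorem integrableOn_coverageIntegral {α γ : ℝ} (hα : 0 < α) (hγ : 0 < γ) :
    IntegrableOn (fun x : ℝ => x ^ (-2 / α) / (1 + x)) (Ioi γ) := by
  have hexp : -2 / α - 1 < -1 := by
    have : -2 / α < 0 := div_neg_of_neg_of_pos (by norm_num) hα
    linarith
  refine (integrableOn_Ioi_rpow_of_lt hexp hγ).mono' ?_ ?_
  · exact ((measurable_id.pow_const _).div (measurable_id.const_add 1)).aestronglyMeasurable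
  · refine (ae_restrict_mem measurableSet_Ioi).mono fun x hx => ?_
    have hx0 : 0 < x := hγ.trans hx
    rw [Real.norm_of_nonneg (by positivity), Real.rpow_sub_one hx0.ne']
    exact div_le_div_of_nonneg_left (by positivity) hx0 (by linarith)

theorem coverageIntegral_nonneg {α γ : ℝ} (hγ : 0 < γ) : 0 ≤ coverageIntegral α γ :=
  setIntegral_nonneg measurableSet_Ioi fun x hx => by
    have hx0 : 0 < x := hγ.trans hx
    positivity

theorem intervalIntegrable_inv_one_add {x : ℝ} (hx : 0 ≤ x) :
    IntervalIntegrable (fun t : ℝ => (1 + t)⁻¹ / Real.log 2) volume 0 x := by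
  refine ContinuousOn.intervalIntegrable (ContinuousOn.div_const (ContinuousOn.inv₀
    (by fun_prop) fun t ht => ?_) _)
  rw [uIcc_of_le hx] at ht
  linarith [ht.1]

theorem integral_inv_one_add {x : ℝ} (hx : 0 ≤ x) :
    ∫ t in (0 : ℝ)..x, (1 + t)⁻¹ / Real.log 2 = Real.logb 2 (1 + x) := by
  rw [intervalIntegral.integral_div, intervalIntegral.integral_comp_add_left (fun t => t⁻¹),
    integral_inv_of_pos (by norm_num) (by linarith), Real.logb]
  simp

section SIR

variable {Ω : Type*} [MeasurableSpace Ω] {Φ : Ω → Set Plane} {α γ : ℝ}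

/-- Measurability of SIR events is available for thresholds of at least `1` only; restricting to
coverage raises every level `a` to `max a γ ≥ 1`. -/
theorem IsRandomPointSet.measurable_indicator_sir (h : IsRandomPointSet Φ) (hα : 0 < α)
    (hγ : 1 ≤ γ) : Measurable ({p : Plane × Ω | InCoverage α γ (Φ p.2) p.1}.indicator
      fun p => sir α (Φ p.2) p.1) := by
  refine measurable_of_Ioi fun a => ?_
  by_cases ha : a = ∞
  · simp [ha]
  · have : ({p : Plane × Ω | InCoverage α γ (Φ p.2) p.1}.indicator
        fun p => sir α (Φ p.2) p.1) ⁻¹' Ioi a =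
        {p : Plane × Ω | max a (ENNReal.ofReal γ) < sir α (Φ p.2) p.1} := by
      ext p
      by_cases hp : InCoverage α γ (Φ p.2) p.1
      · simp [indicator, hp, show ENNReal.ofReal γ < sir α (Φ p.2) p.1 from hp]
      · simp [indicator, hp, not_lt.1 (show ¬ ENNReal.ofReal γ < sir α (Φ p.2) p.1 from hp)]
    rw [this]
    exact h.measurableSet_lt_sir hα (le_max_of_le_right (by simpa using hγ))
      (max_lt (lt_top_iff_ne_top.2 ha) ENNReal.ofReal_lt_top).ne

theorem IsRandomPointSet.measurableSet_inCoverage (h : IsRandomPointSet Φ) (hα : 0 < α)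
    (hγ : 1 ≤ γ) : MeasurableSet {p : Plane × Ω | InCoverage α γ (Φ p.2) p.1} :=
  h.measurableSet_lt_sir hα (by simpa using hγ) ENNReal.ofReal_ne_top

theorem IsRandomPointSet.measurable_coveredEfficiency (h : IsRandomPointSet Φ) (hα : 0 < α)
    (hγ : 1 ≤ γ) : Measurable ({p : Plane × Ω | InCoverage α γ (Φ p.2) p.1}.indicator
      fun p => spectralEfficiency α (Φ p.2) p.1) := by
  have hm : Measurable fun x : ℝ≥0∞ => ENNReal.ofReal (Real.logb 2 (1 + x.toReal)) :=
    ENNReal.measurable_ofReal.comp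
      ((Real.measurable_log.comp (ENNReal.measurable_toReal.const_add 1)).div_const _)
  have := (hm.comp (h.measurable_indicator_sir hα hγ)).indicator
    (h.measurableSet_inCoverage hα hγ)
  convert this using 1
  ext p
  by_cases hp : InCoverage α γ (Φ p.2) p.1 <;> simp [indicator, hp, spectralEfficiency]

/-- Layer-cake formula with `log₂ (1 + x) = ∫₀ˣ dt / ((1 + t) log 2)`. Levels up to `γ` contribute
with the full coverage probability, levels above with the Pareto tail, and `P(SIR > 1) = γ^(2/α)
P(SIR > γ)` makes the coverage probability a common factor. -/
theorem IsPoissonProcess.lintegral_coveredEfficiency {P : Measure Ω} [IsProbabilityMeasure P]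
    {c : ℝ≥0∞} (hc : c ≠ ∞) (h : IsPoissonProcess Φ (c • (volume : Measure Plane)) P)
    (hα : 0 < α) (hγ : 1 ≤ γ) (u : Plane) :
    ∫⁻ ω, {ω | InCoverage α γ (Φ ω) u}.indicator (fun ω => spectralEfficiency α (Φ ω) u) ω ∂P =
      ENNReal.ofReal
          (Real.logb 2 (1 + γ) + γ ^ (2 / α) * coverageIntegral α γ / Real.log 2) *
        P {ω | InCoverage α γ (Φ ω) u} := by
  have hp := h.isRandomPointSet
  have hγ0 : 0 < γ := one_pos.trans_le hγ
  have hlog2 : 0 < Real.log 2 := Real.log_pos (by norm_num)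
  let C : Set Ω := {ω | InCoverage α γ (Φ ω) u}
  have hC : MeasurableSet C := measurable_prodMk_left (hp.measurableSet_inCoverage hα hγ)
  let f : Ω → ℝ := fun ω => (sir α (Φ ω) u).toReal
  let K : ℝ≥0∞ := P {ω | 1 < sir α (Φ ω) u}
  have hfm : AEMeasurable f (P.restrict C) := by
    refine ⟨fun ω => (C.indicator (fun ω => sir α (Φ ω) u) ω).toReal,
      ((hp.measurable_indicator_sir hα hγ).comp measurable_prodMk_left).ennreal_toReal, ?_⟩
    filter_upwards [ae_restrict_mem hC] with ω hω
    simp [f, indicator_of_mem hω]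
  have htail : ∀ t : ℝ, γ ≤ t →
      P.restrict C {ω | t < f ω} = ENNReal.ofReal (t ^ (-(2 / α))) * K := by
    intro t ht
    rw [Measure.restrict_apply' hC, ← h.measure_lt_sir_eq_rpow hc hα (hγ.trans ht)]
    refine measure_congr ?_
    filter_upwards [measure_eq_zero_iff_ae_notMem.1 (h.measure_sir_eq_top hc hα u)] with ω hω
    have hω : sir α (Φ ω) u ≠ ∞ := hω
    have hiff : ENNReal.ofReal t < sir α (Φ ω) u ↔ t < f ω :=
      ENNReal.ofReal_lt_iff_lt_toReal (hγ0.le.trans ht) hω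
    refine propext ⟨fun hx => hiff.2 hx.1, fun hx => ⟨hiff.1 hx, ?_⟩⟩
    exact lt_of_le_of_lt (ENNReal.ofReal_le_ofReal ht) hx
  have hbody : ∀ t ∈ Ioc 0 γ, P.restrict C {ω | t < f ω} = P C := by
    intro t ht
    rw [Measure.restrict_apply' hC]
    refine measure_congr ?_
    filter_upwards [measure_eq_zero_iff_ae_notMem.1 (h.measure_sir_eq_top hc hα u)] with ω hω
    have hω : sir α (Φ ω) u ≠ ∞ := hω
    refine propext ⟨fun hx => hx.2, fun hx => ⟨?_, hx⟩⟩
    exact lt_of_le_of_lt ht.2 ((ENNReal.ofReal_lt_iff_lt_toReal hγ0.le hω).1 hx)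
  have hPC : P C = ENNReal.ofReal (γ ^ (-(2 / α))) * K := h.measure_lt_sir_eq_rpow hc hα hγ u
  have hcake := lintegral_comp_eq_lintegral_meas_lt_mul (f := f)
    (g := fun t => (1 + t)⁻¹ / Real.log 2) (P.restrict C)
    (.of_forall fun ω => ENNReal.toReal_nonneg) hfm
    (fun t ht => intervalIntegrable_inv_one_add ht.le)
    ((ae_restrict_mem measurableSet_Ioi).mono fun t (ht : 0 < t) => by
      show 0 ≤ (1 + t)⁻¹ / Real.log 2
      positivity)
  have hleft : ∫⁻ ω, C.indicator (fun ω => spectralEfficiency α (Φ ω) u) ω ∂P =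
      ∫⁻ ω, ENNReal.ofReal (∫ t in (0 : ℝ)..f ω, (1 + t)⁻¹ / Real.log 2) ∂P.restrict C := by
    rw [lintegral_indicator hC]
    refine lintegral_congr fun ω => ?_
    rw [integral_inv_one_add ENNReal.toReal_nonneg]
    rfl
  have hsplit : Ioi (0 : ℝ) = Ioc 0 γ ∪ Ioi γ := (Ioc_union_Ioi_eq_Ioi hγ0.le).symm
  refine hleft.trans (hcake.trans ?_)
  rw [hsplit, lintegral_union measurableSet_Ioi
    (disjoint_left.2 fun x hx hx' => not_lt.2 hx.2 hx'),
    setLIntegral_congr_fun (g := fun t => P C * ENNReal.ofReal ((1 + t)⁻¹ / Real.log 2))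
      measurableSet_Ioc fun t ht => by
      simp only [hbody t ht],
    setLIntegral_congr_fun (g := fun t => K * ENNReal.ofReal
      (t ^ (-2 / α) / (1 + t) / Real.log 2)) measurableSet_Ioi fun t (ht : γ < t) => by
      have ht0 : 0 < t := hγ0.trans ht
      simp only [htail t ht.le]
      rw [mul_comm _ K, mul_assoc, ← ENNReal.ofReal_mul (by positivity), neg_div]
      congr 2
      ring,
    lintegral_const_mul' _ _ (measure_ne_top _ _), lintegral_const_mul' _ _ (measure_ne_top _ _),
    ← ofReal_integral_eq_lintegral_ofReal
      ((intervalIntegrable_iff_integrableOn_Ioc_of_le hγ0.le).1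
        (intervalIntegrable_inv_one_add hγ0.le))
      ((ae_restrict_mem measurableSet_Ioc).mono fun t ht => by
        have := ht.1
        show 0 ≤ (1 + t)⁻¹ / Real.log 2
        positivity),
    ← ofReal_integral_eq_lintegral_ofReal
      ((integrableOn_coverageIntegral hα hγ0).div_const _)
      ((ae_restrict_mem measurableSet_Ioi).mono fun t (ht : γ < t) => by
        have := hγ0.trans ht
        show 0 ≤ t ^ (-2 / α) / (1 + t) / Real.log 2
        positivity),
    ← intervalIntegral.integral_of_le hγ0.le, integral_inv_one_add hγ0.le, integral_div]
  change P C * _ + K * ENNReal.ofReal (coverageIntegral α γ / Real.log 2) = _ * P C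
  have hA := coverageIntegral_nonneg (α := α) hγ0
  have hK : K = ENNReal.ofReal (γ ^ (2 / α)) * P C := by
    rw [hPC, ← mul_assoc, ← ENNReal.ofReal_mul (by positivity), ← Real.rpow_add hγ0]
    simp
  rw [hK, ENNReal.ofReal_add (Real.logb_nonneg (by norm_num) (by linarith)) (by positivity),
    mul_div_assoc, ENNReal.ofReal_mul (by positivity)]
  ring

end SIR

/-! ### Averaging over the users -/

namespace CRAN

variable {Ω : Type*} [MeasurableSpace Ω] {N : CRAN Ω} {P : Measure Ω}
  {lamR lamU : ℝ}

/-- Measurability is needed for the σ-algebra generated by the RRHs, since independence from the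
users is known only for that one. -/
theorem isRandomPointSet_comap_countFamily (hN : N.IsPoissonNetwork lamR lamU P) :
    @IsRandomPointSet Ω _ (MeasurableSpace.comap (countFamily N.markedRRH) inferInstance) _ _
      N.markedRRH :=
  @IsRandomPointSet.mk Ω _ (MeasurableSpace.comap (countFamily N.markedRRH) inferInstance) _ _ _
    hN.rrh_poisson.locallyFinite fun B hB =>
      (measurable_pi_apply (⟨B, hB⟩ : {B : Set (Plane × unitInterval) // MeasurableSet B})).comp
        (comap_measurable (countFamily N.markedRRH))

variable [IsProbabilityMeasure P]

/-- Campbell's formula for the users, with an integrand that is a function of the RRHs. -/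
theorem lintegral_tsum_users (hN : N.IsPoissonNetwork lamR lamU P) {W : Set Plane}
    (hW : MeasurableSet W) {F : Plane × Ω → ℝ≥0∞}
    (hF : @Measurable _ _ (@Prod.instMeasurableSpace _ _ _
      (MeasurableSpace.comap (countFamily N.markedRRH) inferInstance)) _ F) :
    ∫⁻ ω, ∑' u : ↥(N.users ω ∩ W), F (u, ω) ∂P =
      ENNReal.ofReal lamU * ∫⁻ u in W, ∫⁻ ω, F (u, ω) ∂P := by
  have := sigmaFinite_smul_of_ne_top (volume : Measure Plane)
    (ENNReal.ofReal_ne_top (r := lamU))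
  have hm : Measurable (countFamily N.markedRRH) :=
    measurable_pi_lambda _ fun B => hN.rrh_poisson.measurable_count B B.2
  -- The independent random element is the identity map to `Ω` with the σ-algebra of the RRHs, so
  -- any functional of the RRHs may serve as integrand.
  have hid : @Measurable Ω Ω _ (MeasurableSpace.comap (countFamily N.markedRRH) inferInstance) id :=
    hm.comap_le
  have hind : @IndepFun Ω Ω _ _
      (MeasurableSpace.comap (countFamily N.markedRRH) inferInstance) _ id
      (countFamily N.users) P := by
    refine (@IndepFun_iff_Indep _ _ _ _ (_) _ _ _ _).2 ?_
    rw [MeasurableSpace.comap_id]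
    exact (IndepFun_iff_Indep _ _ _).1 hN.indep
  have hcamp := hN.users_poisson.campbell_of_indepFun
    (mX := MeasurableSpace.comap (countFamily N.markedRRH) inferInstance) hid hind
    (g := (Prod.fst ⁻¹' W).indicator F)
    (@Measurable.indicator _ _ _ _ _ _ _ hF ((@measurable_fst _ _ _
      (MeasurableSpace.comap (countFamily N.markedRRH) inferInstance)) hW))
  have hin : ∀ x ω, (Prod.fst ⁻¹' W).indicator F (x, id ω) =
      W.indicator (fun u => F (u, ω)) x := fun x ω => rfl
  simp_rw [hin] at hcamp
  simp_rw [lintegral_indicator hW] at hcamp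
  simp_rw [hN.users_poisson.isRandomPointSet.setLIntegral_kernel _ hW] at hcamp
  rw [hcamp, lintegral_smul_measure, smul_eq_mul, ← lintegral_indicator hW]
  congr 1
  refine lintegral_congr fun u => ?_
  by_cases hu : u ∈ W <;> simp [hu]

/-- At every location the mean efficiency on coverage is the same constant times the coverage
probability, so the two window averages have this ratio. Cancelling needs the mean number of covered
users to be finite and nonzero; the latter is where `μ > 0` enters. -/
theorem coveredEfficiency_eq (hN : N.IsPoissonNetwork lamR lamU P) (hlamR : 0 < lamR)
    (hlamU : 0 < lamU) {α γ : ℝ} (hα : 2 < α) (hγ : 1 ≤ γ) {W : Set Plane} (hW : MeasurableSet W)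
    (hW0 : volume W ≠ 0) (hW1 : volume W ≠ ∞) {μ : ℝ} (hμ : μ ∈ Ioc (0 : ℝ) 1) :
    N.coveredEfficiency P W α γ μ = ENNReal.ofReal
      (Real.logb 2 (1 + γ) + γ ^ (2 / α) * coverageIntegral α γ / Real.log 2) := by
  have hα0 : 0 < α := by linarith
  have hγ0 : 0 < γ := by linarith
  have h := N.isPoissonProcess_activeRRH hlamR.le ⟨hμ.1.le, hμ.2⟩ hN.rrh_poisson
  have hc : ENNReal.ofReal (lamR * μ) ≠ ∞ := ENNReal.ofReal_ne_top
  have hc0 : ENNReal.ofReal (lamR * μ) ≠ 0 := by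
    simpa using mul_pos hlamR hμ.1
  let C : Set (Plane × Ω) := {p | InCoverage α γ (N.activeRRH μ p.2) p.1}
  have hact := @CRAN.isRandomPointSet_activeRRH Ω N
    (MeasurableSpace.comap (countFamily N.markedRRH) inferInstance)
    (isRandomPointSet_comap_countFamily hN) μ
  have hC := @IsRandomPointSet.measurableSet_inCoverage Ω
    (MeasurableSpace.comap (countFamily N.markedRRH) inferInstance) _ α γ hact hα0 hγ
  have hE := @IsRandomPointSet.measurable_coveredEfficiency Ω
    (MeasurableSpace.comap (countFamily N.markedRRH) inferInstance) _ α γ hact hα0 hγ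
  have hcov : N.meanCovered P W α γ μ = ENNReal.ofReal lamU *
      ∫⁻ u in W, P {ω | InCoverage α γ (N.activeRRH μ ω) u} := by
    refine (lintegral_tsum_users hN hW (F := C.indicator 1)
      (@Measurable.indicator _ _ _ _ _ _ _ (@measurable_const _ _ _ (_) 1) hC)).trans ?_
    congr 1
    refine lintegral_congr fun u => ?_
    exact lintegral_indicator_one
      (measurable_prodMk_left (h.isRandomPointSet.measurableSet_inCoverage hα0 hγ))
  have heff : N.meanCoveredEfficiency P W α γ μ = ENNReal.ofReal
      (Real.logb 2 (1 + γ) + γ ^ (2 / α) * coverageIntegral α γ / Real.log 2) *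
        N.meanCovered P W α γ μ := by
    rw [hcov, mul_left_comm, ← lintegral_const_mul' _ _ ENNReal.ofReal_ne_top]
    refine (lintegral_tsum_users hN hW (F := C.indicator fun p =>
      spectralEfficiency α (N.activeRRH μ p.2) p.1) hE).trans ?_
    congr 1
    exact lintegral_congr fun u => h.lintegral_coveredEfficiency hc hα0 hγ u
  have htop : N.meanCovered P W α γ μ ≠ ∞ := by
    rw [hcov]
    refine ENNReal.mul_ne_top ENNReal.ofReal_ne_top (ne_top_of_le_ne_top hW1 ?_)
    calc _ ≤ ∫⁻ _ in W, 1 := lintegral_mono fun u => prob_le_one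
      _ = volume W := by simp
  have hpos : N.meanCovered P W α γ μ ≠ 0 := by
    rw [hcov]
    refine mul_ne_zero (by simpa using hlamU) fun h0 => hW0 ?_
    have hmeas : Measurable fun u => P {ω | InCoverage α γ (N.activeRRH μ ω) u} :=
      measurable_measure_prodMk_left (h.isRandomPointSet.measurableSet_inCoverage hα0 hγ)
    rw [lintegral_eq_zero_iff hmeas] at h0
    have : ∀ᵐ u ∂(volume.restrict W), False := by
      filter_upwards [h0] with u hu
      have hu : P {ω | ENNReal.ofReal γ < sir α (N.activeRRH μ ω) u} = 0 := hu
      rw [h.measure_lt_sir_eq_rpow hc hα0 hγ] at hu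
      refine mul_ne_zero ?_ (h.measure_one_lt_sir_pos hc hc0 hα u) hu
      simpa using Real.rpow_pos_of_pos hγ0 _
    rw [← Measure.restrict_eq_zero]
    exact ae_eq_bot.1 (Filter.eventually_false_iff_eq_bot.1 this)
  rw [coveredEfficiency, heff, ENNReal.mul_div_cancel_right hpos htop]

end CRAN

/-! ### The threshold -/

theorem lemma1 {Ω : Type*} [MeasurableSpace Ω] (P : Measure Ω) [IsProbabilityMeasure P]
    (N : CRAN Ω) (lamR lamU bw α γ R₀ : ℝ)
    (hlamR : 0 < lamR) (hlamU : 0 < lamU) (hbw : 0 < bw) (hα : 2 < α) (hγ : 1 ≤ γ) (hR₀ : 0 ≤ R₀)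
    (hN : N.IsPoissonNetwork lamR lamU P)
    (W : Set Plane) (hW : MeasurableSet W) (hW0 : volume W ≠ 0) (hW1 : volume W ≠ ∞) :
    (∀ μ ∈ Icc (0 : ℝ) 1,
      ENNReal.ofReal R₀ ≤ N.perUserRate P W lamR lamU bw α γ μ ↔
        minActivity lamR lamU bw α γ R₀ ≤ μ) ∧
    (minActivity lamR lamU bw α γ R₀ ≤ 1 →
      IsLeast {μ : ℝ | μ ∈ Icc (0 : ℝ) 1 ∧
          ENNReal.ofReal R₀ ≤ N.perUserRate P W lamR lamU bw α γ μ}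
        (minActivity lamR lamU bw α γ R₀)) := by
  have hγ0 : 0 < γ := by linarith
  have hlog2 : 0 < Real.log 2 := Real.log_pos (by norm_num)
  let c : ℝ := Real.logb 2 (1 + γ) + γ ^ (2 / α) * coverageIntegral α γ / Real.log 2
  have hc : 0 < c := by
    have h1 : 0 < Real.logb 2 (1 + γ) := Real.logb_pos (by norm_num) (by linarith)
    have h2 := coverageIntegral_nonneg (α := α) hγ0
    positivity
  have hmin : minActivity lamR lamU bw α γ R₀ = R₀ * lamU / (bw * lamR * c) := rfl
  have hmin0 : 0 ≤ minActivity lamR lamU bw α γ R₀ := by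
    rw [hmin]
    positivity
  have hiff : ∀ μ ∈ Icc (0 : ℝ) 1,
      (ENNReal.ofReal R₀ ≤ N.perUserRate P W lamR lamU bw α γ μ ↔
        minActivity lamR lamU bw α γ R₀ ≤ μ) := by
    rintro μ ⟨hμ0, hμ1⟩
    have hrate : N.perUserRate P W lamR lamU bw α γ μ =
        ENNReal.ofReal (bw * (μ * lamR) / lamU * c) := by
      -- At `μ = 0` the bandwidth factor vanishes, so the rate is `0` whatever value the covered
      -- efficiency takes.
      rcases hμ0.eq_or_lt with rfl | hμ
      · simp [CRAN.perUserRate]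
      · rw [CRAN.perUserRate, CRAN.coveredEfficiency_eq hN hlamR hlamU hα hγ hW hW0 hW1 ⟨hμ, hμ1⟩,
          ← ENNReal.ofReal_mul (by positivity)]
    rw [hrate, ENNReal.ofReal_le_ofReal_iff (by positivity), hmin, div_le_iff₀ (by positivity),
      div_mul_eq_mul_div, le_div_iff₀ hlamU]
    ring_nf
  refine ⟨hiff, fun h1 => ⟨⟨⟨hmin0, h1⟩, (hiff _ ⟨hmin0, h1⟩).2 le_rfl⟩, ?_⟩⟩
  rintro μ ⟨hμ, hμ'⟩
  exact (hiff μ hμ).1 hμ'
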